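/- For $f:\{0,1\}^n\to\mathbb R$ and $i\in[n]$ let $\partial_i f(x)=f(x_{i\leftarrow 1})-f(x_{i\leftarrow 0})$. Call $f$ unate if for every $i$ either $\partial_i f\ge 0$ everywhere or $\partial_i f\le 0$ everywhere. The total $\ell_1$-influence of $f$ is $\mathsf{Infl}^1(f)=\sum_{i\in[n]}\mathbf E_x\big[\tfrac12|\partial_i f(x)|\big]$, and $\|f\|_2=(\mathbf E_x[f(x)^2])^{1/2}$, with $x$ uniform in $\{0,1\}^n$. Let $\mathcal C_a^+$ be the set of all unate $f:\{0,1\}^n\to[0,1]$ with $\mathsf{Infl}^1(f)\le a$. Algorithms are programs of a real RAM (real arithmetic and comparisons, integer addition, subtraction and comparison, and array accesses take unit time; obtaining an example takes $n+1$ steps). The output of a learning algorithm is a memory state from which a fixed program without access to examples computes the hypothesis $h:\{0,1\}^n\to\mathbb R$ at any given point. (1) There is an algorithm $\mathcal A$ that, for all $n\ge 2$, $\epsilon>0$ and $a$, given $n,\epsilon,a$ and access to independent uniformly random examples $(x,f(x))$ of any $f\in\mathcal C_a^+$, with probability at least $2/3$ outputs a function $h$ such that $\|f-h\|_2\le\epsilon$.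 Further, $\mathcal A$ runs in time $\tilde O(n)\cdot 2^{O(a^2/\epsilon^4)}$ and uses $\log_2 n\cdot 2^{O(a^2/\epsilon^4)}$ examples, and $h$ can be evaluated at any point within the same time bound. (2) A function $f:\{0,1\}^n\to\mathbb R$, viewed as a set function on $[n]$, is XOS (fractionally subadditive) if $f(A)\le\sum_i\beta_i f(B_i)$ whenever $\beta_i\ge 0$ and $\sum_{i:\,j\in B_i}\beta_i\ge 1$ for all $j\in A$. There is an algorithm that, for all $n\ge 2$ and $\epsilon>0$, given $n,\epsilon$ and access to independent uniformly random examples of any XOS function $f:\{0,1\}^n\to[0,1]$, with probability at least $2/3$ outputs a function $h$ such that $\|f-h\|_2\le\epsilon$; it runs in time $2^{O(1/\epsilon^4)}\,\mathrm{poly}(n)$ and uses $2^{O(1/\epsilon^4)}\log_2 n$ examples, and $h$ can be evaluated at any point within the same time bound. All constants hidden in $O$, $\tilde O$ and $\mathrm{poly}$ are absolute. -/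

import Mathlib

open scoped BigOperators

noncomputable section

namespace RealRAM

/-! ## Real RAM with access to labelled random examples

A program uses finitely many integer variables, real variables, integer arrays and real arrays
(each named by a number).  Integers can be added, subtracted (truncated at `0`) and compared, reals
can be added, subtracted, multiplied, divided and compared; each such operation takes one step.  The
only constants a program may contain are natural numbers and rationals. -/

/-- The `n`-dimensional Boolean cube. -/
abbrev Cube (n : ℕ) : Type := Fin n → Bool

/-- Memory contents, together with the number of examples drawn so far. -/
structure State where
  /-- integer variables -/
  natVar : ℕ → ℕ
  /-- integer arrays: `natArr A i` is cell `i` of array `A` -/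
  natArr : ℕ → ℕ → ℕ
  /-- real variables -/
  realVar : ℕ → ℝ
  /-- real arrays: `realArr A i` is cell `i` of array `A` -/
  realArr : ℕ → ℕ → ℝ
  /-- number of examples drawn so far -/
  drawn : ℕ

/-- Basic instructions. -/
inductive Instr where
  /-- integer variable `i` := `c` -/
  | natConst (i c : ℕ)
  /-- integer variable `i` := integer variable `j` -/
  | natMove (i j : ℕ)
  /-- integer variable `i` := (variable `j`) + (variable `k`) -/
  | natAdd (i j k : ℕ)
  /-- integer variable `i` := max(0, (variable `j`) - (variable `k`)) -/
  | natSub (i j k : ℕ)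
  /-- integer variable `i` := `A[variable j]` for the integer array `A` -/
  | natLoad (i A j : ℕ)
  /-- `A[variable i]` := integer variable `j` for the integer array `A` -/
  | natStore (A i j : ℕ)
  /-- real variable `i` := `q` -/
  | realConst (i : ℕ) (q : ℚ)
  /-- real variable `i` := real variable `j` -/
  | realMove (i j : ℕ)
  /-- real variable `i` := integer variable `j` -/
  | realOfNat (i j : ℕ)
  | realAdd (i j k : ℕ)
  | realSub (i j k : ℕ)
  | realMul (i j k : ℕ)
  | realDiv (i j k : ℕ)
  /-- real variable `i` := `A[integer variable j]` for the real array `A` -/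
  | realLoad (i A j : ℕ)
  /-- `A[integer variable i]` := real variable `j` for the real array `A` -/
  | realStore (A i j : ℕ)
  /-- request an example `(x, y)`: write the bits of `x` into cells `0, …, n - 1` of the integer
  array `A` and the label `y` into real variable `i` -/
  | draw (A i : ℕ)

/-- Tests. -/
inductive Test where
  | natLt (i j : ℕ)
  | natLe (i j : ℕ)
  | realLt (i j : ℕ)
  | realLe (i j : ℕ)

/-- Programs. -/
inductive Prog where
  | instr (c : Instr)
  | seq (p q : Prog)
  | ifElse (b : Test) (p q : Prog)
  | loop (b : Test) (p : Prog)

/-- The program contains no `draw` instruction. -/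
def Prog.NoDraw : Prog → Prop
  | .instr (.draw _ _) => False
  | .instr _ => True
  | .seq p q => p.NoDraw ∧ q.NoDraw
  | .ifElse _ p q => p.NoDraw ∧ q.NoDraw
  | .loop _ p => p.NoDraw

namespace State

def setNat (s : State) (i v : ℕ) : State :=
  { s with natVar := Function.update s.natVar i v }

def setReal (s : State) (i : ℕ) (v : ℝ) : State :=
  { s with realVar := Function.update s.realVar i v }

def setNatArr (s : State) (A i v : ℕ) : State :=
  { s with natArr := Function.update s.natArr A (Function.update (s.natArr A) i v) }

def setRealArr (s : State) (A i : ℕ) (v : ℝ) : State :=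
  { s with realArr := Function.update s.realArr A (Function.update (s.realArr A) i v) }

/-- Write the bits of a point of the cube into cells `0, …, n - 1` of integer array `A`. -/
def writePoint {n : ℕ} (s : State) (A : ℕ) (x : Cube n) : State :=
  { s with
    natArr := Function.update s.natArr A
      (fun i => if h : i < n then (x ⟨i, h⟩).toNat else s.natArr A i) }

/-- Initial memory: integer variable `0` holds the dimension `n`, the real variables `0, 1, …` hold
the real parameters, everything else is `0`. -/
def init (n : ℕ) (params : List ℝ) : State where
  natVar := fun i => if i = 0 then n else 0
  natArr := fun _ _ => 0
  realVar := fun i => params.getD i 0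
  realArr := fun _ _ => 0
  drawn := 0

end State

/-- Effect of an instruction; `ex k` is the `k`-th example handed out by the example oracle. -/
def Instr.exec {n : ℕ} (ex : ℕ → Cube n × ℝ) (s : State) : Instr → State
  | .natConst i c => s.setNat i c
  | .natMove i j => s.setNat i (s.natVar j)
  | .natAdd i j k => s.setNat i (s.natVar j + s.natVar k)
  | .natSub i j k => s.setNat i (s.natVar j - s.natVar k)
  | .natLoad i A j => s.setNat i (s.natArr A (s.natVar j))
  | .natStore A i j => s.setNatArr A (s.natVar i) (s.natVar j)
  | .realConst i q => s.setReal i (q : ℝ)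
  | .realMove i j => s.setReal i (s.realVar j)
  | .realOfNat i j => s.setReal i (s.natVar j : ℝ)
  | .realAdd i j k => s.setReal i (s.realVar j + s.realVar k)
  | .realSub i j k => s.setReal i (s.realVar j - s.realVar k)
  | .realMul i j k => s.setReal i (s.realVar j * s.realVar k)
  | .realDiv i j k => s.setReal i (s.realVar j / s.realVar k)
  | .realLoad i A j => s.setReal i (s.realArr A (s.natVar j))
  | .realStore A i j => s.setRealArr A (s.natVar i) (s.realVar j)
  | .draw A i =>
      { (s.writePoint A (ex s.drawn).1).setReal i (ex s.drawn).2 with drawn := s.drawn + 1 }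

/-- Number of steps taken by an instruction: `n + 1` for an example (its `n` bits and its label),
one for anything else. -/
def Instr.cost (n : ℕ) : Instr → ℕ
  | .draw _ _ => n + 1
  | _ => 1

def Test.Holds (s : State) : Test → Prop
  | .natLt i j => s.natVar i < s.natVar j
  | .natLe i j => s.natVar i ≤ s.natVar j
  | .realLt i j => s.realVar i < s.realVar j
  | .realLe i j => s.realVar i ≤ s.realVar j

/-- `Exec ex p s s' t`: started in `s`, with examples served from `ex`, the program `p` halts in
state `s'` after exactly `t` steps. -/
inductive Exec {n : ℕ} (ex : ℕ → Cube n × ℝ) : Prog → State → State → ℕ → Prop where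
  | instr (c : Instr) (s : State) : Exec ex (.instr c) s (c.exec ex s) (c.cost n)
  | seq {p q : Prog} {s s' s'' : State} {t t' : ℕ} :
      Exec ex p s s' t → Exec ex q s' s'' t' → Exec ex (.seq p q) s s'' (t + t')
  | ifTrue {b : Test} {p q : Prog} {s s' : State} {t : ℕ} :
      b.Holds s → Exec ex p s s' t → Exec ex (.ifElse b p q) s s' (t + 1)
  | ifFalse {b : Test} {p q : Prog} {s s' : State} {t : ℕ} :
      ¬ b.Holds s → Exec ex q s s' t → Exec ex (.ifElse b p q) s s' (t + 1)
  | loopTrue {b : Test} {p : Prog} {s s' s'' : State} {t t' : ℕ} :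
      b.Holds s → Exec ex p s s' t → Exec ex (.loop b p) s' s'' t' →
        Exec ex (.loop b p) s s'' (t + t' + 1)
  | loopFalse {b : Test} {p : Prog} {s : State} :
      ¬ b.Holds s → Exec ex (.loop b p) s s 1

end RealRAM

namespace Learning

open RealRAM

/-! ## Functions on the cube -/

/-- Discrete derivative in direction `i`. -/
def deriv {n : ℕ} (i : Fin n) (f : Cube n → ℝ) (x : Cube n) : ℝ :=
  f (Function.update x i true) - f (Function.update x i false)

/-- In every coordinate the function is non-decreasing or non-increasing. -/
def Unate {n : ℕ} (f : Cube n → ℝ) : Prop :=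
  ∀ i, (∀ x, 0 ≤ deriv i f x) ∨ (∀ x, deriv i f x ≤ 0)

/-- `ℓ₁`-influence of variable `i`. -/
def influence {n : ℕ} (f : Cube n → ℝ) (i : Fin n) : ℝ := 𝔼 x, |1 / 2 * deriv i f x|

/-- Total `ℓ₁`-influence. -/
def totalInfluence {n : ℕ} (f : Cube n → ℝ) : ℝ := ∑ i, influence f i

/-- `ℓ₂`-norm with respect to the uniform distribution. -/
def l2norm {n : ℕ} (f : Cube n → ℝ) : ℝ := Real.sqrt (𝔼 x, f x ^ 2)

/-- Unate functions with range in `[0,1]` and total `ℓ₁`-influence at most `a`. -/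
def unateClass (n : ℕ) (a : ℝ) : Set (Cube n → ℝ) :=
  {f | Unate f ∧ (∀ x, f x ∈ Set.Icc (0 : ℝ) 1) ∧ totalInfluence f ≤ a}

/-- XOS (fractionally subadditive) functions; points of the cube are read as subsets of `[n]`. -/
def IsXOS {n : ℕ} (f : Cube n → ℝ) : Prop :=
  ∀ (A : Cube n) (k : ℕ) (β : Fin k → ℝ) (B : Fin k → Cube n),
    (∀ i, 0 ≤ β i) →
    (∀ j, A j = true → 1 ≤ ∑ i with B i j = true, β i) →
    f A ≤ ∑ i, β i * f (B i)

/-- XOS functions with range in `[0,1]`. -/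
def xosClass (n : ℕ) : Set (Cube n → ℝ) :=
  {f | IsXOS f ∧ ∀ x, f x ∈ Set.Icc (0 : ℝ) 1}

/-! ## Learning from uniform random examples -/

/-- A learning algorithm: a program that draws examples and leaves a description of its hypothesis
in memory, and a program without access to examples that evaluates the described hypothesis at a
point. -/
structure Learner where
  train : Prog
  eval : Prog
  eval_noDraw : eval.NoDraw

/-- The stream of examples of `f` at the points `ω 0, ω 1, …`. -/
def examples {n : ℕ} (f : Cube n → ℝ) (ω : ℕ → Cube n) (k : ℕ) : Cube n × ℝ := (ω k, f (ω k))

/-- The law of a sequence of independent uniform points of the cube. -/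
def uniformSeq (n : ℕ) : MeasureTheory.Measure (ℕ → Cube n) :=
  MeasureTheory.Measure.infinitePi fun _ : ℕ => (PMF.uniformOfFintype (Cube n)).toMeasure

/-- On target `f` and example points `ω`, the learner halts within `T` steps having drawn at most
`m` examples, and outputs `h`: from the final memory, with `x` in integer array `0`, the evaluation
program halts within `T` steps with `h x` in real variable `0`. -/
def Learner.Outputs (L : Learner) {n : ℕ} (params : List ℝ) (f : Cube n → ℝ) (ω : ℕ → Cube n)
    (T m : ℝ) (h : Cube n → ℝ) : Prop :=
  ∃ (s : State) (t : ℕ), Exec (examples f ω) L.train (State.init n params) s t ∧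
    (t : ℝ) ≤ T ∧ (s.drawn : ℝ) ≤ m ∧
    ∀ x : Cube n, ∃ (s' : State) (t' : ℕ),
      Exec (examples f ω) L.eval (s.writePoint 0 x) s' t' ∧ (t' : ℝ) ≤ T ∧ s'.realVar 0 = h x

/-- Given the real parameters `params` and uniform examples of any `f ∈ F`, the learner always stays
within time `T` and `m` examples, and with probability at least `2/3` its hypothesis `h` satisfies
`‖f - h‖₂ ≤ ε`. -/
def Learner.Learns (L : Learner) {n : ℕ} (params : List ℝ) (F : Set (Cube n → ℝ))
    (ε T m : ℝ) : Prop :=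
  ∀ f ∈ F, (∀ ω, ∃ h, L.Outputs params f ω T m h) ∧
    2 / 3 ≤ (uniformSeq n).real
      {ω | ∃ h, L.Outputs params f ω T m h ∧ l2norm (fun x => f x - h x) ≤ ε}

end Learning

end

/-!
The learner estimates Fourier coefficients. Write `I i` for the `ℓ₁`-influence of coordinate `i`; it
is the `ℓ₁`-norm of `D i f = ½ ∂ᵢ f`, whose Fourier coefficients are those of `f` at the sets
containing `i`. Let `f` be unate with values in `[0, 1]` and total influence at most `a`.

* As `|D i f| ≤ 1`, the weighted sum `∑ S, #S * f̂(S) ^ 2` is at most `a`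
  (`sum_card_mul_fourier_sq_le`), so degree `d ≈ 12 a / ε ^ 2` captures `f` up to a small multiple of
  `ε ^ 2`.
* By Bonami's lemma (`expect_pow_four_le`) the weight of `D i f` up to degree `d` is at most
  `3 ^ d * I i ^ (3 / 2)` (`sq_sum_fourier_sq_le`). Hence coordinates with `I i ≤ 36 ^ (-d)` may be
  ignored (`sum_compl_lowSets_le`), and for unate `f` the others are visible in the degree-one
  coefficients, since `I i = |f̂({i})|` (`abs_fourier_singleton`).
* Hoeffding's inequality and a union bound estimate all coefficients of degree at most `d` to
  accuracy `2 ^ (-12 d ^ 2)` from `⌈log₂ n⌉ * 2 ^ (32 d ^ 2)` examples. At most `2 ^ (15 d)`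
  coordinates `J` have a large degree-one estimate, so only `2 ^ (15 d ^ 2)` coefficients are kept
  and their errors add up to at most `2 ^ (-9 d ^ 2)` (`expect_sq_sub_hypothesis_le`).

This accuracy has to be compared with `ε`, which is not bounded below in terms of `d`. But if
`a ≤ 72 ^ (-d)`, then no coordinate is influential, so the variance of `f` is at most `ε ^ 2 / 6`
and the label of a single example is a good hypothesis; the same holds if `12 a ≤ ε ^ 2`. Otherwise
`d * ε ^ 2 ≥ 12 * 72 ^ (-d)`, and `d ≤ 24 a / ε ^ 2` keeps all costs within `2 ^ O(a ^ 2 / ε ^ 4)`.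

The empirical coefficients are never listed: the hypothesis is the average over the examples
`(z, y)` of `y * ∑ χ_S(x) χ_S(z)`, the sum over all `S ⊆ J` with `#S ≤ d`, and the inner sum is
computed by dynamic programming over the coordinates (`lowSumProg`). Correctness and running time of
the programs are proved with invariants, in a logic of total correctness with time bounds
(`Halts`).

XOS functions with values in `[0, 1]` are monotone, and their marginals at a set sum to at most the
value there, so they are unate with total influence at most `1` (`xosClass_subset_unateClass`); the
learner for unate functions applies to them with `a = 1`.
-/

namespace Learning

open RealRAM Finset

variable {n : ℕ}

/-! ### Fourier analysis on the cube and Bonami's lemma -/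

/-- The value `1` or `-1` of a bit. -/
def sign (b : Bool) : ℝ := if b then 1 else -1

lemma sign_mul_self (b : Bool) : sign b * sign b = 1 := by cases b <;> simp [sign]

lemma abs_sign (b : Bool) : |sign b| = 1 := by cases b <;> simp [sign]

lemma sign_not (b : Bool) : sign (!b) = -sign b := by cases b <;> simp [sign]

/-- The Walsh character of a set of coordinates. -/
def chi (S : Finset (Fin n)) (x : Cube n) : ℝ := ∏ i ∈ S, sign (x i)

lemma chi_mul_self (S : Finset (Fin n)) (x : Cube n) : chi S x * chi S x = 1 := by
  simp [chi, ← Finset.prod_mul_distrib, sign_mul_self]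

lemma abs_chi (S : Finset (Fin n)) (x : Cube n) : |chi S x| = 1 := by
  simp [chi, Finset.abs_prod, abs_sign]

lemma chi_insert {S : Finset (Fin n)} {i : Fin n} (hi : i ∉ S) (x : Cube n) :
    chi (insert i S) x = sign (x i) * chi S x := by
  simp [chi, Finset.prod_insert hi]

lemma chi_eq_mul_erase {S : Finset (Fin n)} {i : Fin n} (hi : i ∈ S) (x : Cube n) :
    chi S x = sign (x i) * chi (S.erase i) x := by
  rw [← chi_insert (Finset.notMem_erase i S), Finset.insert_erase hi]

/-- Negating coordinate `i`. -/
def flip (i : Fin n) : Cube n ≃ Cube n :=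
  Function.Involutive.toPerm (fun x => Function.update x i (!x i)) (fun x => by simp)

lemma flip_apply (i : Fin n) (x : Cube n) : flip i x = Function.update x i (!x i) := rfl

lemma flip_apply_self (i : Fin n) (x : Cube n) : flip i x i = !x i := by simp [flip_apply]

lemma chi_congr {S : Finset (Fin n)} {x y : Cube n} (h : ∀ i ∈ S, x i = y i) :
    chi S x = chi S y :=
  Finset.prod_congr rfl fun i hi => by rw [h i hi]

lemma chi_update {S : Finset (Fin n)} {i : Fin n} (hi : i ∉ S) (x : Cube n) (b : Bool) :
    chi S (Function.update x i b) = chi S x :=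
  chi_congr fun j hj => Function.update_of_ne (by rintro rfl; exact hi hj) _ _

lemma chi_flip {S : Finset (Fin n)} {i : Fin n} (hi : i ∉ S) (x : Cube n) :
    chi S (flip i x) = chi S x := chi_update hi _ _

lemma expect_flip (i : Fin n) (F : Cube n → ℝ) : 𝔼 x, F (flip i x) = 𝔼 x, F x :=
  Fintype.expect_equiv (flip i) _ _ fun _ => rfl

lemma expect_mul_sign_eq_zero {i : Fin n} {F : Cube n → ℝ} (hF : ∀ x, F (flip i x) = F x) :
    𝔼 x, F x * sign (x i) = 0 := by
  have h := expect_flip i (fun x => F x * sign (x i))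
  simp only [hF, flip_apply_self, sign_not, mul_neg, Finset.expect_neg_distrib] at h
  linarith

lemma expect_chi_mul_chi (S T : Finset (Fin n)) :
    𝔼 x, chi S x * chi T x = if S = T then 1 else 0 := by
  split_ifs with h
  · subst h
    simp [chi_mul_self]
  · have key : ∀ S T : Finset (Fin n), ¬ S ⊆ T → 𝔼 x, chi S x * chi T x = 0 := by
      intro S T h
      obtain ⟨i, hS, hT⟩ := Finset.not_subset.1 h
      rw [← expect_mul_sign_eq_zero (i := i) (F := fun x => chi (S.erase i) x * chi T x)]
      · refine Finset.expect_congr rfl fun x _ => ?_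
        rw [chi_eq_mul_erase hS]
        ring
      · intro x
        rw [chi_flip (Finset.notMem_erase i S), chi_flip hT]
    by_cases h1 : S ⊆ T
    · have h2 : ¬ T ⊆ S := fun h2 => h (Finset.Subset.antisymm h1 h2)
      simpa only [mul_comm] using key T S h2
    · exact key S T h1

/-- The Walsh–Fourier coefficient of `f` at `S`. -/
noncomputable def fourier (f : Cube n → ℝ) (S : Finset (Fin n)) : ℝ := 𝔼 x, f x * chi S x

lemma sum_chi_mul_chi (x y : Cube n) :
    ∑ S : Finset (Fin n), chi S x * chi S y = if x = y then 2 ^ n else 0 := by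
  have h : ∏ i : Fin n, (1 + sign (x i) * sign (y i)) = ∑ S, chi S x * chi S y := by
    rw [Finset.prod_one_add, Finset.powerset_univ]
    simp [chi, Finset.prod_mul_distrib]
  rw [← h]
  split_ifs with hxy
  · subst hxy
    simp [sign_mul_self]
    norm_num
  · obtain ⟨i, hi⟩ := Function.ne_iff.1 hxy
    refine Finset.prod_eq_zero (Finset.mem_univ i) ?_
    cases hx : x i <;> cases hy : y i <;> simp_all [sign]

lemma sum_fourier_mul_chi (f : Cube n → ℝ) (x : Cube n) : ∑ S, fourier f S * chi S x = f x := by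
  have h : ∑ S, fourier f S * chi S x = 𝔼 y, f y * ∑ S, chi S y * chi S x := by
    simp only [fourier, Finset.expect_mul, Finset.mul_sum, Finset.expect_sum_comm, mul_assoc]
  rw [h]
  simp only [sum_chi_mul_chi]
  rw [Fintype.expect_eq_sum_div_card]
  simp

lemma expect_sq_sum_chi (F : Finset (Finset (Fin n))) (b : Finset (Fin n) → ℝ) :
    𝔼 x, (∑ S ∈ F, b S * chi S x) ^ 2 = ∑ S ∈ F, b S ^ 2 := by
  calc 𝔼 x, (∑ S ∈ F, b S * chi S x) ^ 2
      = 𝔼 x, ∑ S ∈ F, ∑ T ∈ F, b S * b T * (chi S x * chi T x) := by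
        refine Finset.expect_congr rfl fun x _ => ?_
        rw [sq, Finset.sum_mul_sum]
        exact Finset.sum_congr rfl fun S _ => Finset.sum_congr rfl fun T _ => by ring
    _ = ∑ S ∈ F, ∑ T ∈ F, b S * b T * 𝔼 x, chi S x * chi T x := by
        simp only [Finset.mul_expect, Finset.expect_sum_comm]
    _ = ∑ S ∈ F, b S ^ 2 := by
        refine Finset.sum_congr rfl fun S hS => ?_
        simp [expect_chi_mul_chi, hS, sq]

lemma parseval (f : Cube n → ℝ) : 𝔼 x, f x ^ 2 = ∑ S, fourier f S ^ 2 := by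
  rw [← expect_sq_sum_chi]
  simp [sum_fourier_mul_chi]

/-- Approximating `f` by a combination of the characters in `F`: the squared error is the squared
error of the coefficients plus the Fourier weight outside `F`. -/
lemma expect_sq_sub_sum_chi (f : Cube n → ℝ) (F : Finset (Finset (Fin n)))
    (c : Finset (Fin n) → ℝ) :
    𝔼 x, (f x - ∑ S ∈ F, c S * chi S x) ^ 2 =
      ∑ S ∈ F, (fourier f S - c S) ^ 2 + ∑ S ∈ Fᶜ, fourier f S ^ 2 := by
  classical
  have h : ∀ x, f x - ∑ S ∈ F, c S * chi S x =
      ∑ S, (fourier f S - if S ∈ F then c S else 0) * chi S x := by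
    intro x
    simp only [sub_mul, Finset.sum_sub_distrib, sum_fourier_mul_chi, ite_mul, zero_mul]
    simp
  simp only [h, expect_sq_sum_chi]
  rw [← Finset.sum_add_sum_compl F]
  congr 1
  · exact Finset.sum_congr rfl fun S hS => by simp [hS]
  · exact Finset.sum_congr rfl fun S hS => by simp [Finset.mem_compl.1 hS]

lemma sum_fourier_sq_le (f : Cube n → ℝ) (F : Finset (Finset (Fin n))) :
    ∑ S ∈ F, fourier f S ^ 2 ≤ 𝔼 x, f x ^ 2 := by
  rw [parseval]
  exact Finset.sum_le_sum_of_subset_of_nonneg (Finset.subset_univ _) fun _ _ _ => sq_nonneg _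

/-- Bonami's lemma: for multilinear polynomials of degree at most `d`, the fourth moment is at most
`9 ^ d` times the square of the second moment. The induction adds one variable `s` at a time,
writing the polynomial as `p + s * q` with `q` of smaller degree. -/
lemma expect_pow_four_le (U : Finset (Fin n)) : ∀ (d : ℕ) (c : Finset (Fin n) → ℝ),
    (∀ S ⊆ U, d < #S → c S = 0) →
    𝔼 x, (∑ S ∈ U.powerset, c S * chi S x) ^ 4 ≤ 9 ^ d * (∑ S ∈ U.powerset, c S ^ 2) ^ 2 := by
  classical
  induction U using Finset.induction_on with
  | empty =>
    intro d c _
    simp only [Finset.powerset_empty, Finset.sum_singleton, chi, Finset.prod_empty, mul_one]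
    rw [Fintype.expect_const]
    have h1 : (1 : ℝ) ≤ 9 ^ d := one_le_pow₀ (by norm_num)
    nlinarith [sq_nonneg (c ∅ ^ 2)]
  | insert i U hi ih =>
    intro d c hc
    set p : Cube n → ℝ := fun x => ∑ S ∈ U.powerset, c S * chi S x with hp
    set q : Cube n → ℝ := fun x => ∑ S ∈ U.powerset, c (insert i S) * chi S x with hq
    set A := ∑ S ∈ U.powerset, c S ^ 2 with hA
    set B := ∑ S ∈ U.powerset, c (insert i S) ^ 2 with hB
    have hA0 : 0 ≤ A := Finset.sum_nonneg fun _ _ => sq_nonneg _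
    have hB0 : 0 ≤ B := Finset.sum_nonneg fun _ _ => sq_nonneg _
    have hsum : ∀ x, ∑ S ∈ (insert i U).powerset, c S * chi S x = p x + sign (x i) * q x := by
      intro x
      rw [Finset.sum_powerset_insert hi, hp, hq, Finset.mul_sum]
      congr 1
      refine Finset.sum_congr rfl fun S hS => ?_
      rw [chi_insert (fun h => hi (Finset.mem_powerset.1 hS h))]
      ring
    have hflip : ∀ (e : Finset (Fin n) → ℝ) x, ∑ S ∈ U.powerset, e S * chi S (flip i x) =
        ∑ S ∈ U.powerset, e S * chi S x := fun e x =>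
      Finset.sum_congr rfl fun S hS => by
        rw [chi_flip (fun h => hi (Finset.mem_powerset.1 hS h))]
    have hpf : ∀ x, p (flip i x) = p x := fun x => hflip _ x
    have hqf : ∀ x, q (flip i x) = q x := fun x => hflip _ x
    have hcross := expect_mul_sign_eq_zero (i := i)
      (F := fun x => 4 * p x ^ 3 * q x + 4 * p x * q x ^ 3) (fun x => by simp only [hpf, hqf])
    have hexp : 𝔼 x, (p x + sign (x i) * q x) ^ 4 =
        𝔼 x, p x ^ 4 + 6 * 𝔼 x, p x ^ 2 * q x ^ 2 + 𝔼 x, q x ^ 4 := by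
      rw [← add_zero (𝔼 x, p x ^ 4 + 6 * 𝔼 x, p x ^ 2 * q x ^ 2 + 𝔼 x, q x ^ 4), ← hcross,
        Finset.mul_expect, ← Finset.expect_add_distrib, ← Finset.expect_add_distrib,
        ← Finset.expect_add_distrib]
      refine Finset.expect_congr rfl fun x _ => ?_
      have hs := sign_mul_self (x i)
      generalize sign (x i) = s at hs
      have hs2 : s ^ 2 = 1 := by rw [sq, hs]
      have hs3 : s ^ 3 = s := by rw [pow_succ, hs2, one_mul]
      have hs4 : s ^ 4 = 1 := by rw [pow_succ, hs3, hs]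
      ring_nf
      rw [hs2, hs3, hs4]
      ring
    simp only [hsum]
    rw [hexp, Finset.sum_powerset_insert hi]
    have hpA : 𝔼 x, p x ^ 4 ≤ 9 ^ d * A ^ 2 :=
      ih d c fun S hS h => hc S (hS.trans (Finset.subset_insert _ _)) h
    have hcard : ∀ S ⊆ U, #(insert i S) = #S + 1 := fun S hS =>
      Finset.card_insert_of_notMem fun h => hi (hS h)
    cases d with
    | zero =>
      have hz : ∀ S ⊆ U, c (insert i S) = 0 := fun S hS =>
        hc _ (Finset.insert_subset_insert _ hS) (by rw [hcard S hS]; omega)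
      have hq0 : ∀ x, q x = 0 := fun x => Finset.sum_eq_zero fun S hS => by
        rw [hz S (Finset.mem_powerset.1 hS), zero_mul]
      have hBz : B = 0 := Finset.sum_eq_zero fun S hS => by
        rw [hz S (Finset.mem_powerset.1 hS)]; norm_num
      change _ ≤ 9 ^ 0 * (A + B) ^ 2
      simp only [hq0, hBz]
      simpa using hpA
    | succ d =>
      have hqB : 𝔼 x, q x ^ 4 ≤ 9 ^ d * B ^ 2 :=
        ih d (fun S => c (insert i S)) fun S hS h =>
          hc _ (Finset.insert_subset_insert _ hS) (by rw [hcard S hS]; omega)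
      have hcs := Finset.expect_mul_sq_le_sq_mul_sq (univ : Finset (Cube n))
        (fun x => p x ^ 2) (fun x => q x ^ 2)
      simp only [← pow_mul] at hcs
      norm_num at hcs
      have hpq : 𝔼 x, p x ^ 2 * q x ^ 2 ≤ 3 * 9 ^ d * (A * B) := by
        refine abs_le_of_sq_le_sq' ?_ (by positivity) |>.2
        refine hcs.trans ?_
        calc (𝔼 x, p x ^ 4) * 𝔼 x, q x ^ 4 ≤ (9 ^ (d + 1) * A ^ 2) * (9 ^ d * B ^ 2) := by
              refine mul_le_mul hpA hqB (Finset.expect_nonneg fun x _ => by positivity)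
                (by positivity)
          _ = (3 * 9 ^ d * (A * B)) ^ 2 := by ring
      have h9 : (0 : ℝ) ≤ 9 ^ d * B ^ 2 := by positivity
      calc 𝔼 x, p x ^ 4 + 6 * 𝔼 x, p x ^ 2 * q x ^ 2 + 𝔼 x, q x ^ 4
          ≤ 9 ^ (d + 1) * A ^ 2 + 6 * (3 * 9 ^ d * (A * B)) + 9 ^ d * B ^ 2 := by linarith
        _ ≤ 9 ^ (d + 1) * (A + B) ^ 2 := by
          rw [pow_succ]
          nlinarith

/-- The level inequality for bounded functions, obtained from Bonami's lemma and two applications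
of the Cauchy–Schwarz inequality: the low-degree Fourier weight of `D` is at most
`3 ^ d * (𝔼 |D|) ^ (3 / 2)`. -/
lemma sq_sum_fourier_sq_le {D : Cube n → ℝ} (hD : ∀ x, |D x| ≤ 1) {d : ℕ}
    {F : Finset (Finset (Fin n))} (hF : ∀ S ∈ F, #S ≤ d) :
    (∑ S ∈ F, fourier D S ^ 2) ^ 2 ≤ 9 ^ d * (𝔼 x, |D x|) ^ 3 := by
  classical
  set s := ∑ S ∈ F, fourier D S ^ 2 with hs
  set I := 𝔼 x, |D x| with hI
  set g : Cube n → ℝ := fun x => ∑ S ∈ F, fourier D S * chi S x with hg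
  have hI0 : 0 ≤ I := Finset.expect_nonneg fun x _ => abs_nonneg _
  have hs0 : 0 ≤ s := Finset.sum_nonneg fun _ _ => sq_nonneg _
  have h4 : 𝔼 x, g x ^ 4 ≤ 9 ^ d * s ^ 2 := by
    have h := expect_pow_four_le (univ : Finset (Fin n)) d
      (fun S => if S ∈ F then fourier D S else 0) fun S _ hS => if_neg fun h => by
        have := hF S h
        omega
    simpa [Finset.powerset_univ, ite_mul, ite_pow, hg, hs] using h
  have h1 : s = 𝔼 x, g x * D x := by
    simp only [hg, Finset.sum_mul, Finset.expect_sum_comm, hs]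
    refine Finset.sum_congr rfl fun S _ => ?_
    rw [sq]
    nth_rw 2 [fourier]
    rw [Finset.mul_expect]
    exact Finset.expect_congr rfl fun x _ => by ring
  have h2 : s ≤ 𝔼 x, (|g x| * √|D x|) * √|D x| := by
    rw [h1]
    refine Finset.expect_le_expect fun x _ => ?_
    rw [mul_assoc, Real.mul_self_sqrt (abs_nonneg _), ← abs_mul]
    exact le_abs_self _
  have h3 : (𝔼 x, (|g x| * √|D x|) * √|D x|) ^ 2 ≤ (𝔼 x, g x ^ 2 * |D x|) * I := by
    have h := Finset.expect_mul_sq_le_sq_mul_sq (univ : Finset (Cube n))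
      (fun x => |g x| * √|D x|) (fun x => √|D x|)
    simpa [mul_pow, Real.sq_sqrt] using h
  have h5 : (𝔼 x, g x ^ 2 * |D x|) ^ 2 ≤ (𝔼 x, g x ^ 4) * I := by
    have h := Finset.expect_mul_sq_le_sq_mul_sq (univ : Finset (Cube n))
      (fun x => g x ^ 2) (fun x => |D x|)
    simp only [← pow_mul] at h
    norm_num at h
    refine h.trans (mul_le_mul_of_nonneg_left ?_ (Finset.expect_nonneg fun x _ => by positivity))
    refine Finset.expect_le_expect fun x _ => ?_
    rw [← sq_abs]
    nlinarith [hD x, abs_nonneg (D x)]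
  have h6 : s ^ 2 ≤ (𝔼 x, g x ^ 2 * |D x|) * I := (pow_le_pow_left₀ hs0 h2 2).trans h3
  have h7 : s ^ 2 * s ^ 2 ≤ s ^ 2 * (9 ^ d * I ^ 3) := by
    calc s ^ 2 * s ^ 2 ≤ ((𝔼 x, g x ^ 2 * |D x|) * I) ^ 2 := by
          rw [← sq]; exact pow_le_pow_left₀ (sq_nonneg s) h6 2
      _ = (𝔼 x, g x ^ 2 * |D x|) ^ 2 * I ^ 2 := by ring
      _ ≤ (9 ^ d * s ^ 2 * I) * I ^ 2 := by
          refine mul_le_mul_of_nonneg_right (h5.trans ?_) (sq_nonneg I)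
          exact mul_le_mul_of_nonneg_right h4 hI0
      _ = s ^ 2 * (9 ^ d * I ^ 3) := by ring
  rcases hs0.eq_or_lt with h0 | h0
  · rw [← h0, zero_pow two_ne_zero]
    positivity
  · exact le_of_mul_le_mul_left h7 (by positivity)

/-! ### Influences and low-degree concentration -/

lemma expect_eq_expect_update (i : Fin n) (F : Cube n → ℝ) :
    𝔼 x, F x = 𝔼 x, 1 / 2 * (F (Function.update x i true) + F (Function.update x i false)) := by
  have h : ∀ x, F (Function.update x i true) + F (Function.update x i false) =
      F x + F (flip i x) := by
    intro x
    cases hx : x i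
    · rw [flip_apply, hx, ← hx, Function.update_eq_self, hx, Bool.not_false, add_comm]
    · rw [flip_apply, hx, ← hx, Function.update_eq_self, hx, Bool.not_true]
  simp only [h, ← Finset.mul_expect, Finset.expect_add_distrib, expect_flip]
  ring

lemma fourier_deriv (f : Cube n → ℝ) {S : Finset (Fin n)} {i : Fin n} (hi : i ∈ S) :
    fourier (fun x => 1 / 2 * deriv i f x) (S.erase i) = fourier f S := by
  unfold fourier
  rw [expect_eq_expect_update i fun x => f x * chi S x]
  refine Finset.expect_congr rfl fun x _ => ?_
  rw [chi_eq_mul_erase hi, chi_eq_mul_erase hi, chi_update (Finset.notMem_erase i S),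
    chi_update (Finset.notMem_erase i S), Function.update_self, Function.update_self]
  simp only [deriv, sign]
  norm_num
  ring

lemma abs_half_deriv_le {f : Cube n → ℝ} (hf : ∀ x, f x ∈ Set.Icc (0 : ℝ) 1) (i : Fin n)
    (x : Cube n) : |1 / 2 * deriv i f x| ≤ 1 := by
  have h1 := hf (Function.update x i true)
  have h2 := hf (Function.update x i false)
  rw [deriv, abs_le]
  constructor <;> linarith [h1.1, h1.2, h2.1, h2.2]

lemma influence_nonneg (f : Cube n → ℝ) (i : Fin n) : 0 ≤ influence f i :=
  Finset.expect_nonneg fun _ _ => abs_nonneg _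

lemma totalInfluence_nonneg (f : Cube n → ℝ) : 0 ≤ totalInfluence f :=
  Finset.sum_nonneg fun i _ => influence_nonneg f i

/-- For unate functions the influences can be read off the degree-one Fourier coefficients. -/
lemma abs_fourier_singleton {f : Cube n → ℝ} (hf : Unate f) (i : Fin n) :
    |fourier f {i}| = influence f i := by
  have h : fourier f {i} = 𝔼 x, 1 / 2 * deriv i f x := by
    rw [← fourier_deriv f (Finset.mem_singleton_self i)]
    simp [fourier, chi]
  rw [h, influence]
  rcases hf i with h0 | h0
  · have h1 : ∀ x, |1 / 2 * deriv i f x| = 1 / 2 * deriv i f x := fun x =>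
      abs_of_nonneg (by linarith [h0 x])
    simp only [h1]
    exact abs_of_nonneg (Finset.expect_nonneg fun x _ => by linarith [h0 x])
  · have h1 : ∀ x, |1 / 2 * deriv i f x| = -(1 / 2 * deriv i f x) := fun x =>
      abs_of_nonpos (by linarith [h0 x])
    simp only [h1, Finset.expect_neg_distrib]
    refine abs_of_nonpos ?_
    rw [← neg_nonneg, ← Finset.expect_neg_distrib]
    exact Finset.expect_nonneg fun x _ => by linarith [h0 x]

/-- Summing a Fourier weight over the sets containing `i` is summing the weight of the derivative in
direction `i` over these sets with `i` erased. -/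
lemma sum_fourier_sq_eq_deriv (f : Cube n → ℝ) (i : Fin n) {F : Finset (Finset (Fin n))}
    (hF : ∀ S ∈ F, i ∈ S) :
    ∑ S ∈ F, fourier f S ^ 2 =
      ∑ S ∈ F.image (·.erase i), fourier (fun x => 1 / 2 * deriv i f x) S ^ 2 := by
  rw [Finset.sum_image]
  · exact Finset.sum_congr rfl fun S hS => by rw [fourier_deriv f (hF S hS)]
  · intro S hS T hT h
    rw [← Finset.insert_erase (hF S hS), ← Finset.insert_erase (hF T hT)]
    exact congrArg (insert i) h

lemma sum_card_mul_fourier_sq_le {f : Cube n → ℝ} (hf : ∀ x, f x ∈ Set.Icc (0 : ℝ) 1) :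
    ∑ S, (#S : ℝ) * fourier f S ^ 2 ≤ totalInfluence f := by
  have h : ∑ S, (#S : ℝ) * fourier f S ^ 2 =
      ∑ i, ∑ S with i ∈ S, fourier f S ^ 2 := by
    simp only [Finset.sum_filter]
    rw [Finset.sum_comm]
    refine Finset.sum_congr rfl fun S _ => ?_
    rw [← Finset.sum_filter, Finset.sum_const, nsmul_eq_mul]
    simp
  rw [h, totalInfluence]
  refine Finset.sum_le_sum fun i _ => ?_
  rw [sum_fourier_sq_eq_deriv f i fun S hS => (Finset.mem_filter.1 hS).2]
  refine (sum_fourier_sq_le _ _).trans ?_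
  refine Finset.expect_le_expect fun x _ => ?_
  rw [← sq_abs]
  nlinarith [abs_half_deriv_le hf i x, abs_nonneg (1 / 2 * deriv i f x)]

/-- The sets of at most `d` coordinates from `J`. -/
def lowSets (J : Finset (Fin n)) (d : ℕ) : Finset (Finset (Fin n)) := {S ∈ J.powerset | #S ≤ d}

lemma mem_lowSets {J S : Finset (Fin n)} {d : ℕ} : S ∈ lowSets J d ↔ S ⊆ J ∧ #S ≤ d := by
  simp [lowSets]

lemma card_lowSets_le (J : Finset (Fin n)) (d : ℕ) : #(lowSets J d) ≤ (#J + 1) ^ d := by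
  classical
  induction d with
  | zero =>
    have h : lowSets J 0 ⊆ {∅} := by
      intro S hS
      rw [mem_lowSets] at hS
      simpa using hS.2
    simpa using Finset.card_le_card h
  | succ d ih =>
    have h : lowSets J (d + 1) ⊆
        lowSets J d ∪ (J ×ˢ lowSets J d).image fun p => insert p.1 p.2 := by
      intro S hS
      rw [mem_lowSets] at hS
      rcases S.eq_empty_or_nonempty with rfl | ⟨i, hi⟩
      · exact Finset.mem_union_left _ (mem_lowSets.2 ⟨hS.1, by simp⟩)
      · refine Finset.mem_union_right _ (Finset.mem_image.2 ⟨(i, S.erase i), ?_, ?_⟩)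
        · refine Finset.mem_product.2 ⟨hS.1 hi, mem_lowSets.2 ⟨(S.erase_subset i).trans hS.1, ?_⟩⟩
          rw [Finset.card_erase_of_mem hi]
          omega
        · exact Finset.insert_erase hi
    calc #(lowSets J (d + 1)) ≤ #(lowSets J d) + #(J ×ˢ lowSets J d) :=
          (Finset.card_le_card h).trans ((Finset.card_union_le _ _).trans
            (Nat.add_le_add_left Finset.card_image_le _))
      _ = (#J + 1) * #(lowSets J d) := by rw [Finset.card_product]; ring
      _ ≤ (#J + 1) ^ (d + 1) := by
          rw [pow_succ, mul_comm]
          exact Nat.mul_le_mul_right _ ih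

lemma sum_biUnion_le {ι α : Type*} [DecidableEq ι] [DecidableEq α] (s : Finset ι)
    (t : ι → Finset α) {g : α → ℝ} (hg : ∀ x, 0 ≤ g x) :
    ∑ x ∈ s.biUnion t, g x ≤ ∑ i ∈ s, ∑ x ∈ t i, g x := by
  induction s using Finset.induction_on with
  | empty => simp
  | insert i s hi ih =>
    rw [Finset.biUnion_insert, Finset.sum_insert hi]
    refine (le_add_of_nonneg_right (Finset.sum_nonneg fun x _ => hg x)).trans
      (Finset.sum_union_inter.le.trans ?_)
    exact add_le_add le_rfl ih

/-- A function with small total influence has little Fourier weight of degree above `d`; and little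
of its weight up to degree `d` involves variables of influence at most `η ^ 2`. -/
lemma sum_compl_lowSets_le {f : Cube n → ℝ} (hf : ∀ x, f x ∈ Set.Icc (0 : ℝ) 1)
    {J : Finset (Fin n)} {d : ℕ} {η : ℝ} (hη : 0 ≤ η) (hJ : ∀ i ∉ J, influence f i ≤ η ^ 2) :
    ∑ S ∈ (lowSets J d)ᶜ, fourier f S ^ 2 ≤
      totalInfluence f / (d + 1) + 3 ^ d * η * totalInfluence f := by
  classical
  have hd : (0 : ℝ) < d + 1 := by positivity
  have hsplit : (lowSets J d)ᶜ ⊆ ({S | d < #S} : Finset (Finset (Fin n))) ∪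
      Jᶜ.biUnion fun i => ({S | i ∈ S ∧ #S ≤ d} : Finset (Finset (Fin n))) := by
    intro S hS
    rw [Finset.mem_compl, mem_lowSets] at hS
    by_cases h : d < #S
    · exact Finset.mem_union_left _ (by simpa using h)
    · have hSJ : ¬ S ⊆ J := fun h' => hS ⟨h', by omega⟩
      obtain ⟨i, hi, hiJ⟩ := Finset.not_subset.1 hSJ
      refine Finset.mem_union_right _ (Finset.mem_biUnion.2 ⟨i, by simpa using hiJ, ?_⟩)
      simpa using ⟨hi, by omega⟩
  have hhigh : ∑ S : Finset (Fin n) with d < #S, fourier f S ^ 2 ≤ totalInfluence f / (d + 1) := by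
    rw [le_div_iff₀ hd, Finset.sum_mul]
    refine le_trans ?_ (sum_card_mul_fourier_sq_le hf)
    refine (Finset.sum_le_sum fun S hS => ?_).trans
      (Finset.sum_le_sum_of_subset_of_nonneg (Finset.filter_subset (fun S => d < #S) _)
        fun S _ _ => by positivity)
    rw [mul_comm]
    refine mul_le_mul_of_nonneg_right ?_ (sq_nonneg _)
    exact_mod_cast (Finset.mem_filter.1 hS).2
  have hlow : ∀ i ∈ Jᶜ, ∑ S : Finset (Fin n) with i ∈ S ∧ #S ≤ d, fourier f S ^ 2 ≤
      3 ^ d * η * influence f i := by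
    intro i hi
    have hI := hJ i (Finset.mem_compl.1 hi)
    have hI0 := influence_nonneg f i
    rw [sum_fourier_sq_eq_deriv f i fun S hS => (Finset.mem_filter.1 hS).2.1]
    refine abs_le_of_sq_le_sq' ?_ (by positivity) |>.2
    refine (sq_sum_fourier_sq_le (abs_half_deriv_le hf i) (d := d) ?_).trans ?_
    · intro T hT
      obtain ⟨S, hS, rfl⟩ := Finset.mem_image.1 hT
      exact (Finset.card_le_card (Finset.erase_subset _ _)).trans (Finset.mem_filter.1 hS).2.2
    · change 9 ^ d * influence f i ^ 3 ≤ _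
      calc 9 ^ d * influence f i ^ 3 = 9 ^ d * influence f i ^ 2 * influence f i := by ring
        _ ≤ 9 ^ d * influence f i ^ 2 * η ^ 2 := by gcongr
        _ = (3 ^ d * η * influence f i) ^ 2 := by
          rw [show (9 : ℝ) = 3 ^ 2 by norm_num, ← pow_mul]
          ring
  calc ∑ S ∈ (lowSets J d)ᶜ, fourier f S ^ 2
      ≤ ∑ S : Finset (Fin n) with d < #S, fourier f S ^ 2 +
        ∑ i ∈ Jᶜ, ∑ S : Finset (Fin n) with i ∈ S ∧ #S ≤ d, fourier f S ^ 2 := by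
        refine (Finset.sum_le_sum_of_subset_of_nonneg hsplit fun _ _ _ => sq_nonneg _).trans ?_
        refine (le_add_of_nonneg_right (Finset.sum_nonneg fun _ _ => sq_nonneg _)).trans
          (Finset.sum_union_inter.le.trans ?_)
        refine add_le_add le_rfl ?_
        exact sum_biUnion_le _ _ fun _ => sq_nonneg _
    _ ≤ totalInfluence f / (d + 1) + ∑ i ∈ Jᶜ, 3 ^ d * η * influence f i :=
        add_le_add hhigh (Finset.sum_le_sum hlow)
    _ ≤ totalInfluence f / (d + 1) + 3 ^ d * η * totalInfluence f := by
        refine add_le_add le_rfl ?_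
        rw [totalInfluence, Finset.mul_sum]
        exact Finset.sum_le_sum_of_subset_of_nonneg (Finset.subset_univ _) fun i _ _ =>
          mul_nonneg (by positivity) (influence_nonneg f i)

/-! ### XOS functions -/

lemma IsXOS.mono {f : Cube n → ℝ} (hf : IsXOS f) {A B : Cube n}
    (h : ∀ j, A j = true → B j = true) : f A ≤ f B := by
  have := hf A 1 (fun _ => 1) (fun _ => B) (by simp) (fun j hj => by simp [h j hj])
  simpa using this

/-- The marginals of an XOS function at a set `A` sum to at most its value: the sets `A \ {i}`, with
weights `1 / (#A - 1)`, cover `A` fractionally. -/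
lemma IsXOS.sum_marginals_le {f : Cube n → ℝ} (hf : IsXOS f) (h0 : ∀ x, 0 ≤ f x) (A : Cube n) :
    ∑ i with A i = true, (f A - f (Function.update A i false)) ≤ f A := by
  classical
  set s : Finset (Fin n) := {i | A i = true} with hs
  rcases Nat.lt_or_ge #s 2 with hc | hc
  · calc ∑ i ∈ s, (f A - f (Function.update A i false)) ≤ ∑ i ∈ s, f A :=
          Finset.sum_le_sum fun i _ => by linarith [h0 (Function.update A i false)]
      _ = #s * f A := by rw [Finset.sum_const, nsmul_eq_mul]
      _ ≤ 1 * f A := mul_le_mul_of_nonneg_right (by exact_mod_cast Nat.le_of_lt_succ hc) (h0 A)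
      _ = f A := one_mul _
  · have hpos : (0 : ℝ) < #s - 1 := by
      have : (2 : ℝ) ≤ #s := by exact_mod_cast hc
      linarith
    have key := hf A n (fun i => if i ∈ s then 1 / ((#s : ℝ) - 1) else 0)
      (fun i => Function.update A i false)
      (fun i => by split_ifs <;> positivity)
      (fun j hj => by
        have hset : ({i | Function.update A i false j = true} : Finset (Fin n)) =
            univ.erase j := by
          ext i
          by_cases h : j = i
          · subst h; simp
          · simp [Function.update_of_ne h, hj, Ne.symm h]
        rw [hset, Finset.sum_ite_mem, Finset.sum_const, nsmul_eq_mul]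
        have hj' : j ∈ s := by simp [hs, hj]
        rw [show univ.erase j ∩ s = s.erase j by ext; simp, Finset.card_erase_of_mem hj',
          Nat.cast_sub (by omega)]
        rw [Nat.cast_one, mul_one_div_cancel hpos.ne'])
    simp only [ite_mul, zero_mul, Finset.sum_ite_mem, Finset.univ_inter, ← Finset.mul_sum] at key
    rw [one_div, ← div_eq_inv_mul, le_div_iff₀ hpos] at key
    rw [Finset.sum_sub_distrib, Finset.sum_const, nsmul_eq_mul]
    linarith

lemma xosClass_subset_unateClass : xosClass n ⊆ unateClass n 1 := by
  rintro f ⟨hf, h01⟩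
  have hd : ∀ i x, 0 ≤ deriv i f x := fun i x => by
    refine sub_nonneg.2 (hf.mono fun j hj => ?_)
    by_cases h : j = i
    · subst h; simp
    · simpa [Function.update_of_ne h] using hj
  refine ⟨fun i => Or.inl (hd i), h01, ?_⟩
  have h : ∀ i, influence f i =
      𝔼 x : Cube n, if x i = true then f x - f (Function.update x i false) else 0 := by
    intro i
    rw [expect_eq_expect_update i, influence]
    refine Finset.expect_congr rfl fun x _ => ?_
    rw [abs_of_nonneg (by linarith [hd i x])]
    simp [deriv]
  rw [totalInfluence]
  simp only [h]
  rw [← Finset.expect_sum_comm]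
  refine Finset.expect_le Finset.univ_nonempty fun x _ => ?_
  rw [← Finset.sum_filter]
  exact (hf.sum_marginals_le (fun x => (h01 x).1) x).trans (h01 x).2

/-! ### Random examples -/

section Sampling

open MeasureTheory ProbabilityTheory

instance : IsProbabilityMeasure (uniformSeq n) := by
  unfold uniformSeq
  infer_instance

lemma integral_uniformSeq_apply (k : ℕ) (g : Cube n → ℝ) :
    ∫ ω, g (ω k) ∂uniformSeq n = 𝔼 x, g x := by
  have h := Measure.infinitePi_map_eval
    (fun _ : ℕ => (PMF.uniformOfFintype (Cube n)).toMeasure) k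
  have hg : Measurable g := measurable_of_finite g
  rw [uniformSeq, ← integral_map (φ := fun ω : ℕ → Cube n => ω k) (f := g)
    (measurable_pi_apply k).aemeasurable hg.aestronglyMeasurable]
  change ∫ y, g y ∂(Measure.map (Function.eval k)
    (Measure.infinitePi fun _ : ℕ => (PMF.uniformOfFintype (Cube n)).toMeasure)) = _
  rw [h, PMF.integral_eq_sum, Fintype.expect_eq_sum_div_card, Finset.sum_div]
  refine Finset.sum_congr rfl fun x _ => ?_
  simp only [PMF.uniformOfFintype_apply, ENNReal.toReal_inv, ENNReal.toReal_natCast, smul_eq_mul]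
  rw [div_eq_inv_mul]

lemma iIndepFun_uniformSeq (g : Cube n → ℝ) :
    iIndepFun (fun (k : ℕ) (ω : ℕ → Cube n) => g (ω k)) (uniformSeq n) :=
  iIndepFun_infinitePi (X := fun _ => g) fun _ => measurable_of_finite g

lemma measureReal_sum_ge_le {g : Cube n → ℝ} (hg : ∀ x, |g x| ≤ 1) (m : ℕ) {δ : ℝ} (hδ : 0 ≤ δ) :
    (uniformSeq n).real {ω | m * δ ≤ ∑ k ∈ range m, (g (ω k) - 𝔼 x, g x)} ≤
      Real.exp (-(m * δ ^ 2 / 2)) := by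
  have hsub : ∀ k < m, HasSubgaussianMGF (fun ω : ℕ → Cube n => g (ω k) - 𝔼 x, g x)
      ((‖(1 : ℝ) - (-1)‖₊ / 2) ^ 2) (uniformSeq n) := by
    intro k _
    rw [← integral_uniformSeq_apply k g]
    exact hasSubgaussianMGF_of_mem_Icc
      ((measurable_of_finite g).comp (measurable_pi_apply k)).aemeasurable
      (Filter.Eventually.of_forall fun ω => abs_le.1 (hg (ω k)))
  have h := HasSubgaussianMGF.measure_sum_range_ge_le_of_iIndepFun
    (iIndepFun_uniformSeq fun x => g x - 𝔼 x, g x) hsub (mul_nonneg (Nat.cast_nonneg m) hδ)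
  refine h.trans (Real.exp_le_exp.2 ?_)
  have hc : ((‖(1 : ℝ) - (-1)‖₊ / 2) ^ 2 : NNReal) = 1 := by
    ext
    simp
    norm_num
  rw [hc]
  rcases Nat.eq_zero_or_pos m with rfl | hm
  · simp
  · have hm' : (m : ℝ) ≠ 0 := by positivity
    refine le_of_eq ?_
    simp only [NNReal.coe_one]
    field_simp

/-- Hoeffding's inequality for the empirical mean of `g` over `m` examples. -/
lemma measureReal_abs_sum_gt_le {g : Cube n → ℝ} (hg : ∀ x, |g x| ≤ 1) (m : ℕ) {δ : ℝ}
    (hδ : 0 ≤ δ) :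
    (uniformSeq n).real {ω | m * δ < |∑ k ∈ range m, g (ω k) - m * 𝔼 x, g x|} ≤
      2 * Real.exp (-(m * δ ^ 2 / 2)) := by
  have h1 := measureReal_sum_ge_le hg m hδ
  have h2 := measureReal_sum_ge_le (g := fun x => -g x) (fun x => by simpa using hg x) m hδ
  rw [two_mul]
  refine (measureReal_mono ?_).trans ((measureReal_union_le _ _).trans (add_le_add h1 h2))
  intro ω hω
  rw [Set.mem_ofPred_eq, lt_abs] at hω
  rcases hω with h | h
  · left
    simpa [Finset.sum_sub_distrib] using h.le
  · right
    simp only [Set.mem_ofPred_eq, Finset.sum_sub_distrib, Finset.sum_neg_distrib,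
      Finset.expect_neg_distrib, Finset.sum_const, Finset.card_range, nsmul_eq_mul]
    linarith

lemma le_measureReal_of_compl_subset {s t : Set (ℕ → Cube n)} (h : sᶜ ⊆ t) :
    1 - (uniformSeq n).real t ≤ (uniformSeq n).real s := by
  have h1 : (1 : ℝ) ≤ (uniformSeq n).real s + (uniformSeq n).real t := by
    rw [← probReal_univ (μ := uniformSeq n), ← Set.union_compl_self s]
    exact (measureReal_union_le _ _).trans (add_le_add le_rfl (measureReal_mono h))
  linarith

/-- Simultaneous estimation of the Fourier coefficients in `F` to accuracy `δ`. -/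
lemma le_measureReal_fourier_estimates {f : Cube n → ℝ} (hf : ∀ x, |f x| ≤ 1)
    (F : Finset (Finset (Fin n))) (m : ℕ) {δ : ℝ} (hδ : 0 ≤ δ) :
    1 - #F * (2 * Real.exp (-(m * δ ^ 2 / 2))) ≤ (uniformSeq n).real
      {ω | ∀ S ∈ F, |∑ k ∈ range m, f (ω k) * chi S (ω k) - m * fourier f S| ≤ m * δ} := by
  set bad : Set (ℕ → Cube n) := ⋃ S ∈ F,
    {ω | m * δ < |∑ k ∈ range m, f (ω k) * chi S (ω k) - m * fourier f S|} with hbad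
  have h1 : (uniformSeq n).real bad ≤ #F * (2 * Real.exp (-(m * δ ^ 2 / 2))) := by
    refine (measureReal_biUnion_finset_le _ _).trans ?_
    refine (Finset.sum_le_sum fun S _ => ?_).trans_eq
      ((Finset.sum_const (2 * Real.exp (-(m * δ ^ 2 / 2)))).trans (nsmul_eq_mul _ _))
    exact measureReal_abs_sum_gt_le (g := fun x => f x * chi S x)
      (fun x => by rw [abs_mul, abs_chi, mul_one]; exact hf x) m hδ
  refine (sub_le_sub_left h1 1).trans (le_measureReal_of_compl_subset ?_)
  intro ω hω
  simp only [Set.mem_compl_iff, Set.mem_ofPred_eq, not_forall, not_le] at hω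
  obtain ⟨S, hS, h⟩ := hω
  exact Set.mem_biUnion hS h

/-- A single example approximates a function of small variance. -/
lemma le_measureReal_constant {f : Cube n → ℝ} {ε : ℝ} (hε : 0 < ε)
    (hf : ∑ S ∈ (lowSets (∅ : Finset (Fin n)) 0)ᶜ, fourier f S ^ 2 ≤ ε ^ 2 / 6) :
    2 / 3 ≤ (uniformSeq n).real {ω | 𝔼 x, (f x - f (ω 0)) ^ 2 ≤ ε ^ 2} := by
  have hlow : lowSets (∅ : Finset (Fin n)) 0 = {∅} := by
    ext S
    simp +contextual [mem_lowSets, Finset.subset_empty]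
  rw [hlow] at hf
  set V := ∑ S ∈ ({∅} : Finset (Finset (Fin n)))ᶜ, fourier f S ^ 2
  have hdist : ∀ y, 𝔼 x, (f x - y) ^ 2 = (fourier f ∅ - y) ^ 2 + V := fun y => by
    simpa [chi] using expect_sq_sub_sum_chi f {∅} fun _ => y
  have hmean : 𝔼 y, (fourier f ∅ - f y) ^ 2 = V := by
    have h := hdist (fourier f ∅)
    rw [sub_self, zero_pow two_ne_zero, zero_add] at h
    rw [← h]
    exact Finset.expect_congr rfl fun x _ => by ring
  have htotal : 𝔼 y, 𝔼 x, (f x - f y) ^ 2 ≤ ε ^ 2 / 3 := by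
    simp only [hdist]
    rw [Finset.expect_add_distrib, hmean, Fintype.expect_const]
    linarith
  have hmarkov := mul_meas_ge_le_integral_of_nonneg (μ := uniformSeq n)
    (f := fun ω : ℕ → Cube n => 𝔼 x, (f x - f (ω 0)) ^ 2)
    (Filter.Eventually.of_forall fun ω => Finset.expect_nonneg fun x _ => sq_nonneg _)
    (by
      refine Integrable.of_bound (C := ∑ y, 𝔼 x, (f x - f y) ^ 2) ?_ ?_
      · exact ((measurable_of_finite (fun y : Cube n => 𝔼 x, (f x - f y) ^ 2)).comp
          (measurable_pi_apply 0)).aestronglyMeasurable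
      · refine Filter.Eventually.of_forall fun ω => ?_
        rw [Real.norm_of_nonneg (Finset.expect_nonneg fun x _ => sq_nonneg _)]
        exact Finset.single_le_sum (f := fun y : Cube n => 𝔼 x, (f x - f y) ^ 2)
          (fun y _ => Finset.expect_nonneg fun x _ => sq_nonneg _) (Finset.mem_univ (ω 0)))
    (ε ^ 2)
  rw [integral_uniformSeq_apply 0 fun y => 𝔼 x, (f x - f y) ^ 2] at hmarkov
  have hbad : (uniformSeq n).real {ω | ε ^ 2 ≤ 𝔼 x, (f x - f (ω 0)) ^ 2} ≤ 1 / 3 := by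
    have h : 0 < ε ^ 2 := by positivity
    nlinarith
  have := le_measureReal_of_compl_subset (s := {ω | 𝔼 x, (f x - f (ω 0)) ^ 2 ≤ ε ^ 2})
    (t := {ω | ε ^ 2 ≤ 𝔼 x, (f x - f (ω 0)) ^ 2}) fun ω hω => by
      rw [Set.mem_compl_iff, Set.mem_ofPred_eq, not_le] at hω
      exact hω.le
  linarith

end Sampling

/-! ### Total correctness of programs with time bounds -/

section Programs

variable {ex ex' : ℕ → Cube n × ℝ}

/-- Total correctness with a time bound: started in `s`, the program `p` halts within `T` steps in a
state satisfying `Q`. -/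
def Halts (ex : ℕ → Cube n × ℝ) (p : Prog) (s : State) (T : ℕ) (Q : State → Prop) : Prop :=
  ∃ (s' : State) (t : ℕ), Exec ex p s s' t ∧ t ≤ T ∧ Q s'

lemma Halts.mono {p : Prog} {s : State} {T T' : ℕ} {Q Q' : State → Prop} (h : Halts ex p s T Q)
    (hT : T ≤ T') (hQ : ∀ s', Q s' → Q' s') : Halts ex p s T' Q' := by
  obtain ⟨s', t, he, ht, hq⟩ := h
  exact ⟨s', t, he, ht.trans hT, hQ s' hq⟩

lemma Halts.seq {p q : Prog} {s : State} {T T' : ℕ} {R Q : State → Prop} (hp : Halts ex p s T R)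
    (hq : ∀ s', R s' → Halts ex q s' T' Q) : Halts ex (.seq p q) s (T + T') Q := by
  obtain ⟨s', t, he, ht, hr⟩ := hp
  obtain ⟨s'', t', he', ht', hq'⟩ := hq s' hr
  exact ⟨s'', t + t', .seq he he', add_le_add ht ht', hq'⟩

lemma Halts.ifElse {b : Test} {p q : Prog} {s : State} {T : ℕ} {Q : State → Prop}
    (hp : b.Holds s → Halts ex p s T Q) (hq : ¬ b.Holds s → Halts ex q s T Q) :
    Halts ex (.ifElse b p q) s (T + 1) Q := by
  by_cases h : b.Holds s
  · obtain ⟨s', t, he, ht, hr⟩ := hp h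
    exact ⟨s', t + 1, .ifTrue h he, by omega, hr⟩
  · obtain ⟨s', t, he, ht, hr⟩ := hq h
    exact ⟨s', t + 1, .ifFalse h he, by omega, hr⟩

/-- A loop whose invariant `I k` counts the iterations done; it runs `N` times. -/
lemma Halts.loop {b : Test} {p : Prog} {s : State} {T N : ℕ} (I : ℕ → State → Prop)
    (h0 : I 0 s) (hb : ∀ k ≤ N, ∀ s, I k s → (b.Holds s ↔ k < N))
    (hp : ∀ k < N, ∀ s, I k s → Halts ex p s T (I (k + 1))) :
    Halts ex (.loop b p) s (N * (T + 1) + 1) (I N) := by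
  have key : ∀ r k s, k + r = N → I k s → Halts ex (.loop b p) s (r * (T + 1) + 1) (I N) := by
    intro r
    induction r with
    | zero =>
      intro k s hk hs
      have hkN : k = N := by omega
      subst hkN
      exact ⟨s, 1, .loopFalse (by rw [hb _ le_rfl s hs]; omega), by omega, hs⟩
    | succ r ih =>
      intro k s hk hs
      obtain ⟨s', t, he, ht, hi⟩ := hp k (by omega) s hs
      obtain ⟨s'', t', he', ht', hi'⟩ := ih (k + 1) s' (by omega) hi
      refine ⟨s'', t + t' + 1, .loopTrue ((hb k (by omega) s hs).2 (by omega)) he he', ?_, hi'⟩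
      calc t + t' + 1 ≤ T + (r * (T + 1) + 1) + 1 := by omega
        _ = (r + 1) * (T + 1) + 1 := by ring
  exact key N 0 s (by omega) h0

/-- Straight-line code. -/
def block (c : Instr) : List Instr → Prog
  | [] => .instr c
  | c' :: cs => .seq (.instr c) (block c' cs)

lemma Halts.block {Q : State → Prop} (cs : List Instr) : ∀ (c : Instr) (s : State) (T : ℕ),
    ((c :: cs).map (Instr.cost n)).sum ≤ T → Q ((c :: cs).foldl (Instr.exec ex) s) →
    Halts ex (block c cs) s T Q := by
  induction cs with
  | nil => exact fun c s T hT hQ => ⟨_, _, .instr c s, by simpa using hT, hQ⟩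
  | cons c' cs ih =>
    intro c s T hT hQ
    obtain ⟨s', t, he, ht, hq⟩ := ih c' (c.exec ex s) _ le_rfl hQ
    refine ⟨s', _, .seq (.instr c s) he, le_trans ?_ hT, hq⟩
    rw [List.map_cons, List.sum_cons]
    omega

/-! ### The training program -/

/-- Compute `d`, `d ^ 2` and `72 ^ d` (integer variables `1`, `12`, real variable `5`), where `d` is
the least positive integer with `12 * a ≤ d * ε ^ 2`. -/
def degreeProg : Prog :=
  .seq (block (.natConst 4 1) [.natConst 1 1, .natConst 12 1, .realMul 2 0 0, .realMove 3 2,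
      .realConst 9 12, .realMul 4 9 1, .realConst 6 72, .realMove 5 6, .realConst 7 1])
    (.loop (.realLt 3 4) (block (.natAdd 12 12 1) [.natAdd 12 12 1, .natAdd 12 12 4, .natAdd 1 1 4,
      .realAdd 3 3 2, .realMul 5 5 6]))

/-- Set the number of examples (integer variable `2`) to `⌈log₂ n⌉ * 2 ^ (32 * d ^ 2)`. -/
def sampleSizeProg : Prog :=
  .seq (block (.natConst 11 1) [.natConst 2 0])
  (.seq (.loop (.natLt 11 0) (block (.natAdd 11 11 11) [.natAdd 2 2 4]))
  (.seq (block (.natAdd 12 12 12) [.natAdd 12 12 12, .natAdd 12 12 12, .natAdd 12 12 12,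
      .natAdd 12 12 12])
    (.loop (.natLt 3 12) (block (.natSub 12 12 4) [.natAdd 2 2 2]))))

/-- Choose the degree and the number of examples. If `12 * a ≤ ε ^ 2` or `a * 72 ^ d ≤ 1`, the
target is almost constant, and one example and degree `0` do. -/
def parameterProg : Prog :=
  .seq degreeProg
  (.seq (block (.realMul 8 1 5) [])
    (.ifElse (.realLe 4 2) (block (.natConst 1 0) [.natConst 2 1])
      (.ifElse (.realLe 8 7) (block (.natConst 1 0) [.natConst 2 1]) sampleSizeProg)))

/-- Draw the examples, storing the labels in real array `1` and the points, as consecutive rows of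
signs, in real array `2`. -/
def drawProg : Prog :=
  .seq (block (.natConst 5 0) [.natConst 8 0, .natConst 4 1, .realConst 7 1])
    (.loop (.natLt 5 2)
      (.seq (block (.draw 0 10) [.realStore 1 5 10, .natConst 6 0])
      (.seq (.loop (.natLt 6 0) (block (.natLoad 7 0 6) [.realOfNat 9 7, .realAdd 9 9 9,
          .realSub 9 9 7, .realStore 2 8 9, .natAdd 6 6 4, .natAdd 8 8 4]))
        (block (.natAdd 5 5 4) []))))

/-- The training program. -/
def trainProg : Prog := .seq parameterProg drawProg

/-- The least `d ≥ 1` with `12 * a ≤ d * ε ^ 2`. -/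
noncomputable def degree (a ε : ℝ) : ℕ := max 1 ⌈12 * a / ε ^ 2⌉₊

lemma one_le_degree (a ε : ℝ) : 1 ≤ degree a ε := le_max_left _ _

lemma lt_degree_iff {a ε : ℝ} (hε : 0 < ε) {j : ℕ} (hj : 1 ≤ j) :
    j < degree a ε ↔ j * ε ^ 2 < 12 * a := by
  rw [degree, lt_max_iff, Nat.lt_ceil, lt_div_iff₀ (by positivity)]
  exact ⟨fun h => h.resolve_left (by omega), Or.inr⟩

lemma halts_degreeProg {a ε : ℝ} (hε : 0 < ε) {s : State} (h0 : s.natVar 0 = n)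
    (h3 : s.natVar 3 = 0) (hd : s.drawn = 0) (hr0 : s.realVar 0 = ε) (hr1 : s.realVar 1 = a) :
    Halts ex degreeProg s (11 + 7 * degree a ε) fun s =>
      s.natVar 0 = n ∧ s.natVar 1 = degree a ε ∧ s.natVar 3 = 0 ∧ s.natVar 4 = 1 ∧
      s.natVar 12 = degree a ε ^ 2 ∧ s.drawn = 0 ∧ s.realVar 1 = a ∧ s.realVar 2 = ε ^ 2 ∧
      s.realVar 4 = 12 * a ∧ s.realVar 5 = 72 ^ degree a ε ∧ s.realVar 7 = 1 := by
  obtain ⟨N, hN⟩ : ∃ N, degree a ε = N + 1 := ⟨_, (Nat.sub_add_cancel (one_le_degree a ε)).symm⟩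
  let I : ℕ → State → Prop := fun j s =>
    s.natVar 0 = n ∧ s.natVar 1 = j + 1 ∧ s.natVar 3 = 0 ∧ s.natVar 4 = 1 ∧
      s.natVar 12 = (j + 1) ^ 2 ∧ s.drawn = 0 ∧ s.realVar 1 = a ∧ s.realVar 2 = ε ^ 2 ∧
      s.realVar 4 = 12 * a ∧ s.realVar 5 = 72 ^ (j + 1) ∧ s.realVar 7 = 1 ∧
      s.realVar 3 = ((j + 1 : ℕ) : ℝ) * ε ^ 2 ∧ s.realVar 6 = 72
  refine Halts.mono (T := 10 + (N * (6 + 1) + 1)) (Q := I N)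
    (Halts.seq (R := I 0) ?_ fun s hs => Halts.loop I hs ?_ ?_) (by omega) ?_
  · refine Halts.block _ _ _ _ (by simp [Instr.cost]) ?_
    simp [I, Instr.exec, State.setNat, State.setReal, h0, h3, hd, hr0, hr1,
      sq]
  · rintro k hk s ⟨-, -, -, -, -, -, -, -, h4, -, -, h3, -⟩
    rw [Test.Holds, h3, h4, ← lt_degree_iff hε (by omega), hN]
    omega
  · rintro k hk s ⟨h0, h1, h3, h4, h12, hd, hr1, hr2, hr4, hr5, hr7, hr3, hr6⟩
    refine Halts.block _ _ _ _ (by simp [Instr.cost]) ?_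
    simp [I, Instr.exec, State.setNat, State.setReal, h0, h1, h3, h4, h12,
      hd, hr1, hr2, hr4, hr5, hr7, hr3, hr6]
    refine ⟨by ring, by ring, by ring⟩
  · rintro s ⟨h0, h1, h3, h4, h12, hd, hr1, hr2, hr4, hr5, hr7, -, -⟩
    rw [hN]
    exact ⟨h0, h1, h3, h4, h12, hd, hr1, hr2, hr4, hr5, hr7⟩

lemma halts_sampleSizeProg {d : ℕ} {Q : ℝ} {s : State} (h0 : s.natVar 0 = n)
    (h1 : s.natVar 1 = d) (h3 : s.natVar 3 = 0) (h4 : s.natVar 4 = 1) (h12 : s.natVar 12 = d ^ 2)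
    (hd : s.drawn = 0) (hQ : s.realVar 5 = Q) :
    Halts ex sampleSizeProg s (9 + 3 * Nat.clog 2 n + 96 * d ^ 2) fun s =>
      s.natVar 0 = n ∧ s.natVar 1 = d ∧ s.natVar 2 = Nat.clog 2 n * 2 ^ (32 * d ^ 2) ∧
      s.drawn = 0 ∧ s.realVar 5 = Q := by
  let F : State → Prop := fun s => s.natVar 0 = n ∧ s.natVar 1 = d ∧ s.natVar 3 = 0 ∧
    s.natVar 4 = 1 ∧ s.drawn = 0 ∧ s.realVar 5 = Q
  let I : ℕ → State → Prop := fun j s =>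
    F s ∧ s.natVar 12 = d ^ 2 ∧ s.natVar 11 = 2 ^ j ∧ s.natVar 2 = j
  let J : ℕ → State → Prop := fun j s =>
    F s ∧ s.natVar 12 = 32 * d ^ 2 - j ∧ s.natVar 2 = Nat.clog 2 n * 2 ^ j
  refine Halts.mono (T := 2 + ((Nat.clog 2 n * (2 + 1) + 1) + (5 + (32 * d ^ 2 * (2 + 1) + 1))))
    (Q := J (32 * d ^ 2))
    (Halts.seq (R := I 0) ?_ fun s hs => Halts.seq (R := I (Nat.clog 2 n)) (Halts.loop I hs ?_ ?_)
      fun s hs => Halts.seq (R := J 0) ?_ fun s hs => Halts.loop J hs ?_ ?_) (by omega) ?_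
  · refine Halts.block _ _ _ _ (by simp [Instr.cost]) ?_
    simp [I, F, Instr.exec, State.setNat, h0, h1, h3, h4, h12, hd, hQ]
  · rintro k hk s ⟨⟨h0, -⟩, -, h11, -⟩
    rw [Test.Holds, h0, h11, ← Nat.lt_clog_iff_pow_lt (by norm_num)]
  · rintro k hk s ⟨⟨h0, h1, h3, h4, hd, hQ⟩, h12, h11, h2⟩
    refine Halts.block _ _ _ _ (by simp [Instr.cost]) ?_
    simp [I, F, Instr.exec, State.setNat, h0, h1, h3, h4, h12, hd, hQ, h11,
      h2]
    ring
  · obtain ⟨⟨h0, h1, h3, h4, hd, hQ⟩, h12, h11, h2⟩ := hs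
    refine Halts.block _ _ _ _ (by simp [Instr.cost]) ?_
    simp [J, F, Instr.exec, State.setNat, h0, h1, h3, h4, h12, hd, hQ, h2]
    ring
  · rintro k hk s ⟨⟨-, -, h3, -⟩, h12, -⟩
    rw [Test.Holds, h3, h12]
    omega
  · rintro k hk s ⟨⟨h0, h1, h3, h4, hd, hQ⟩, h12, h2⟩
    refine Halts.block _ _ _ _ (by simp [Instr.cost]) ?_
    simp [J, F, Instr.exec, State.setNat, h0, h1, h3, h4, h12, hd, hQ, h2]
    exact ⟨by omega, by ring⟩
  · rintro s ⟨⟨h0, h1, h3, h4, hd, hQ⟩, h12, h2⟩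
    exact ⟨h0, h1, h2, hd, hQ⟩

open Classical in
/-- The degree and the number of examples which the learner uses. -/
noncomputable def parameters (n : ℕ) (a ε : ℝ) : ℕ × ℕ :=
  if 12 * a ≤ ε ^ 2 ∨ a * 72 ^ degree a ε ≤ 1 then (0, 1)
  else (degree a ε, Nat.clog 2 n * 2 ^ (32 * degree a ε ^ 2))

lemma halts_parameterProg {a ε : ℝ} (hε : 0 < ε) {s : State} (h0 : s.natVar 0 = n)
    (h3 : s.natVar 3 = 0) (hd : s.drawn = 0) (hr0 : s.realVar 0 = ε) (hr1 : s.realVar 1 = a) :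
    Halts ex parameterProg s
      (23 + 7 * degree a ε + 3 * Nat.clog 2 n + 96 * (parameters n a ε).1 ^ 2) fun s =>
      s.natVar 0 = n ∧ s.natVar 1 = (parameters n a ε).1 ∧
      s.natVar 2 = (parameters n a ε).2 ∧ s.drawn = 0 ∧ s.realVar 5 = 72 ^ degree a ε := by
  let T := 9 + 3 * Nat.clog 2 n + 96 * (parameters n a ε).1 ^ 2
  have hconst : ∀ s : State, (12 * a ≤ ε ^ 2 ∨ a * 72 ^ degree a ε ≤ 1) → s.natVar 0 = n →
      s.drawn = 0 → s.realVar 5 = 72 ^ degree a ε →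
      Halts ex (block (.natConst 1 0) [.natConst 2 1]) s T fun s =>
        s.natVar 0 = n ∧ s.natVar 1 = (parameters n a ε).1 ∧
        s.natVar 2 = (parameters n a ε).2 ∧ s.drawn = 0 ∧ s.realVar 5 = 72 ^ degree a ε := by
    intro s h h0 hd hQ
    refine Halts.block _ _ _ _ (by simp [Instr.cost, T]; omega) ?_
    simp [Instr.exec, State.setNat, h0, hd, hQ, parameters, if_pos h]
  refine Halts.mono (Halts.seq (halts_degreeProg hε h0 h3 hd hr0 hr1) fun s hs =>
    Halts.seq (T := 1) (T' := T + 1 + 1)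
      (R := fun s => s.natVar 0 = n ∧ s.natVar 1 = degree a ε ∧ s.natVar 3 = 0 ∧ s.natVar 4 = 1 ∧
        s.natVar 12 = degree a ε ^ 2 ∧ s.drawn = 0 ∧ s.realVar 2 = ε ^ 2 ∧
        s.realVar 4 = 12 * a ∧ s.realVar 5 = 72 ^ degree a ε ∧ s.realVar 7 = 1 ∧
        s.realVar 8 = a * 72 ^ degree a ε)
      ?_ fun s hs => Halts.ifElse (fun hb => ?_) fun hb => ?_)
    (by omega) fun _ h => h
  · obtain ⟨h0, h1, h3, h4, h12, hd, hr1, hr2, hr4, hr5, hr7⟩ := hs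
    refine Halts.block _ _ _ _ (by simp [Instr.cost]) ?_
    simp [Instr.exec, State.setReal, h0, h1, h3, h4, h12, hd, hr1, hr2, hr4,
      hr5, hr7]
  · obtain ⟨h0, h1, h3, h4, h12, hd, hr2, hr4, hr5, hr7, hr8⟩ := hs
    rw [Test.Holds, hr2, hr4] at hb
    exact (hconst s (Or.inl hb) h0 hd hr5).mono (by omega) fun _ h => h
  · obtain ⟨h0, h1, h3, h4, h12, hd, hr2, hr4, hr5, hr7, hr8⟩ := hs
    rw [Test.Holds, hr2, hr4] at hb
    refine Halts.ifElse (fun hb' => ?_) fun hb' => ?_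
    · rw [Test.Holds, hr7, hr8] at hb'
      exact hconst s (Or.inr hb') h0 hd hr5
    · rw [Test.Holds, hr7, hr8] at hb'
      have hp : parameters n a ε = (degree a ε, Nat.clog 2 n * 2 ^ (32 * degree a ε ^ 2)) :=
        if_neg (not_or.2 ⟨hb, hb'⟩)
      simp only [T, hp]
      exact halts_sampleSizeProg h0 h1 h3 h4 h12 hd hr5

/-- Entry `p` of the table of points: the sign of bit `p % n` of example `p / n`. -/
noncomputable def pointEntry (ex : ℕ → Cube n × ℝ) (p : ℕ) : ℝ :=
  if h : p % n < n then sign ((ex (p / n)).1 ⟨p % n, h⟩) else 0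

lemma pointEntry_eq (ex : ℕ → Cube n × ℝ) (k i : ℕ) (hi : i < n) :
    pointEntry ex (k * n + i) = sign ((ex k).1 ⟨i, hi⟩) := by
  have h1 : (k * n + i) % n = i := by
    rw [mul_comm, Nat.mul_add_mod, Nat.mod_eq_of_lt hi]
  have h2 : (k * n + i) / n = k := by
    rw [mul_comm, Nat.mul_add_div (by omega), Nat.div_eq_of_lt hi, add_zero]
  simp [pointEntry, h1, h2, hi]

/-- The memory after training: dimension, degree, number `m` of examples, threshold, and the first
`m` examples. -/
structure Trained (ex : ℕ → Cube n × ℝ) (d m : ℕ) (Q : ℝ) (s : State) : Prop where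
  dim : s.natVar 0 = n
  degree : s.natVar 1 = d
  size : s.natVar 2 = m
  threshold : s.realVar 5 = Q
  label : ∀ k < m, s.realArr 1 k = (ex k).2
  point : ∀ p < m * n, s.realArr 2 p = pointEntry ex p

lemma halts_drawProg {d m : ℕ} {Q : ℝ} {s : State} (h0 : s.natVar 0 = n)
    (h1 : s.natVar 1 = d) (h2 : s.natVar 2 = m) (hd : s.drawn = 0) (hQ : s.realVar 5 = Q) :
    Halts ex drawProg s (5 + m * (9 * n + 6)) fun s => Trained ex d m Q s ∧ s.drawn = m := by
  let F : ℕ → State → Prop := fun k s => s.natVar 0 = n ∧ s.natVar 1 = d ∧ s.natVar 2 = m ∧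
    s.natVar 4 = 1 ∧ s.natVar 5 = k ∧ s.realVar 5 = Q ∧ s.realVar 7 = 1
  let I : ℕ → State → Prop := fun k s => F k s ∧ s.drawn = k ∧ s.natVar 8 = k * n ∧
    (∀ k' < k, s.realArr 1 k' = (ex k').2) ∧ ∀ p < k * n, s.realArr 2 p = pointEntry ex p
  let J : ℕ → ℕ → State → Prop := fun k i s => F k s ∧ s.drawn = k + 1 ∧
    s.natVar 8 = k * n + i ∧ s.natVar 6 = i ∧ (∀ k' < k + 1, s.realArr 1 k' = (ex k').2) ∧
    (∀ p < k * n + i, s.realArr 2 p = pointEntry ex p) ∧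
    ∀ (j : ℕ) (hj : j < n), s.natArr 0 j = ((ex k).1 ⟨j, hj⟩).toNat
  refine Halts.mono
    (T := 4 + (m * ((n + 3 + ((n * (7 + 1) + 1) + 1)) + 1) + 1))
    (Q := I m)
    (Halts.seq (R := I 0) ?_ fun s hs => Halts.loop I hs ?_ fun k hk s hs =>
      Halts.seq (R := J k 0) ?_ fun s hs => Halts.seq (R := J k n)
        (Halts.loop (J k) hs ?_ ?_) fun s hs => ?_) (le_of_eq (by ring)) ?_
  · refine Halts.block _ _ _ _ (by simp [Instr.cost]) ?_
    simp [I, F, Instr.exec, State.setNat, State.setReal, h0, h1, h2, hd, hQ]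
  · rintro k hk s ⟨⟨h0, h1, h2, h4, h5, hQ, hr7⟩, -⟩
    rw [Test.Holds, h5, h2]
  · obtain ⟨⟨h0, h1, h2, h4, h5, hQ, hr7⟩, hd, h8, hl, hp⟩ := hs
    refine Halts.block _ _ _ _ (by simp [Instr.cost]) ?_
    simp [J, F, Instr.exec, State.setNat, State.setReal, State.setRealArr, State.writePoint,
      Function.update_apply, h0, h1, h2, h4, h5, h8, hd, hQ, hr7]
    refine ⟨fun k' hk' => ?_, hp, fun j hj => by simp [hj]⟩
    split_ifs with h
    · rw [h]
    · exact hl k' (by omega)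
  · rintro i hi s ⟨⟨h0, -⟩, -, -, h6, -⟩
    rw [Test.Holds, h6, h0]
  · rintro i hi s ⟨⟨h0, h1, h2, h4, h5, hQ, hr7⟩, hd, h8, h6, hl, hp, hx⟩
    refine Halts.block _ _ _ _ (by simp [Instr.cost]) ?_
    simp [J, F, Instr.exec, State.setNat, State.setReal, State.setRealArr,
      Function.update_apply, h0, h1, h2, h4, h5, h6, h8, hd, hQ, hr7]
    refine ⟨by ring, fun k' hk' => hl k' (by omega), fun p hpi => ?_, hx⟩
    split_ifs with h
    · rw [h, pointEntry_eq ex k i hi, hx i hi]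
      cases (ex k).1 ⟨i, hi⟩ <;> norm_num [sign]
    · exact hp p (by omega)
  · obtain ⟨⟨h0, h1, h2, h4, h5, hQ, hr7⟩, hd, h8, h6, hl, hp, hx⟩ := hs
    refine Halts.block _ _ _ _ (by simp [Instr.cost]) ?_
    simp [I, F, Instr.exec, State.setNat, h0, h1, h2, h4, h5, h8, hd, hQ,
      hr7]
    have h : (k + 1) * n = k * n + n := by ring
    exact ⟨h.symm, fun k' hk' => hl k' (by omega), fun p hpn => hp p (by omega)⟩
  · rintro s ⟨⟨h0, h1, h2, h4, h5, hQ, hr7⟩, hd, h8, hl, hp⟩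
    exact ⟨⟨h0, h1, h2, hQ, hl, hp⟩, hd⟩

lemma halts_trainProg {a ε : ℝ} (hε : 0 < ε) {s : State} (h0 : s.natVar 0 = n)
    (h3 : s.natVar 3 = 0) (hd : s.drawn = 0) (hr0 : s.realVar 0 = ε) (hr1 : s.realVar 1 = a) :
    Halts ex trainProg s
      (28 + 7 * degree a ε + 3 * Nat.clog 2 n + 96 * (parameters n a ε).1 ^ 2 +
        (parameters n a ε).2 * (9 * n + 6)) fun s =>
      Trained ex (parameters n a ε).1 (parameters n a ε).2 (72 ^ degree a ε) s ∧
        s.drawn = (parameters n a ε).2 :=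
  Halts.mono (Halts.seq (halts_parameterProg hε h0 h3 hd hr0 hr1)
    fun _ ⟨h0, h1, h2, hd, hQ⟩ => halts_drawProg h0 h1 h2 hd hQ) (by omega) fun _ h => h

/-! ### The evaluation program -/

/-- The sum of the multilinear monomials of degree at most `j` in the variables `u i`, `i ∈ U`. -/
noncomputable def lowSum (u : Fin n → ℝ) (U : Finset (Fin n)) (j : ℕ) : ℝ :=
  ∑ S ∈ lowSets U j, ∏ i ∈ S, u i

lemma lowSum_empty (u : Fin n → ℝ) (j : ℕ) : lowSum u ∅ j = 1 := by
  have h : lowSets (∅ : Finset (Fin n)) j = {∅} := by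
    ext S
    simp +contextual [mem_lowSets, Finset.subset_empty]
  simp [lowSum, h]

lemma lowSum_zero (u : Fin n → ℝ) (U : Finset (Fin n)) : lowSum u U 0 = 1 := by
  have h : lowSets U 0 = {∅} := by
    ext S
    simp +contextual [mem_lowSets]
  simp [lowSum, h]

lemma lowSum_insert_succ (u : Fin n → ℝ) {U : Finset (Fin n)} {i : Fin n} (hi : i ∉ U) (j : ℕ) :
    lowSum u (insert i U) (j + 1) = lowSum u U (j + 1) + lowSum u U j * u i := by
  have hS : ∀ S ∈ U.powerset, i ∉ S := fun S hS h => hi (Finset.mem_powerset.1 hS h)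
  simp only [lowSum, lowSets, Finset.sum_filter]
  rw [Finset.sum_powerset_insert hi, Finset.sum_mul]
  congr 1
  refine Finset.sum_congr rfl fun S h => ?_
  rw [Finset.card_insert_of_notMem (hS S h), Finset.prod_insert (hS S h)]
  simp only [Nat.add_le_add_iff_right, ite_mul, zero_mul, mul_comm (u i)]

/-- Fill real array `3` with the signs of the point to be evaluated, replaced by `0` at the
coordinates `i` with `|∑ k, y k * z k i| * Q < m`. -/
def weightProg : Prog :=
  .seq (block (.natConst 4 1) [.natConst 5 0, .realConst 7 1, .realConst 6 0, .realOfNat 11 2])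
    (.loop (.natLt 5 0)
      (.seq (block (.realConst 8 0) [.natConst 6 0, .natMove 8 5])
      (.seq (.loop (.natLt 6 2) (block (.realLoad 9 2 8) [.realLoad 10 1 6, .realMul 9 9 10,
          .realAdd 8 8 9, .natAdd 6 6 4, .natAdd 8 8 0]))
      (.seq (block (.realMul 8 8 5) [.realMul 8 8 8, .realMul 9 11 11])
      (.seq (.ifElse (.realLe 9 8)
          (block (.natLoad 7 0 5) [.realOfNat 9 7, .realAdd 9 9 9, .realSub 9 9 7,
            .realStore 3 5 9])
          (block (.realStore 3 5 6) []))
        (block (.natAdd 5 5 4) []))))))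

/-- Given the variables `u i` as products of real array `3` and the row of real array `2` starting at
integer variable `8`, compute the sum of the multilinear monomials of degree at most `d` into cell
`d` of real array `4`. The cells are updated in descending order, so that each one still finds the
old value of its predecessor. -/
def lowSumProg : Prog :=
  .seq (block (.natConst 7 0) [])
  (.seq (.loop (.natLe 7 1) (block (.realStore 4 7 7) [.natAdd 7 7 4]))
  (.seq (block (.natConst 6 0) [])
    (.loop (.natLt 6 0)
      (.seq (block (.realLoad 9 3 6) [.realLoad 10 2 8, .realMul 9 9 10, .natMove 7 1])
      (.seq (.loop (.natLt 3 7) (block (.natSub 9 7 4) [.realLoad 10 4 9, .realMul 10 10 9,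
          .realLoad 13 4 7, .realAdd 13 13 10, .realStore 4 7 13, .natMove 7 9]))
        (block (.natAdd 6 6 4) [.natAdd 8 8 4]))))))

/-- The evaluation program: average the labels, weighted by the low-degree kernel. -/
def evalProg : Prog :=
  .seq weightProg
  (.seq (block (.natConst 3 0) [.natConst 5 0, .natConst 8 0, .realConst 12 0])
  (.seq (.loop (.natLt 5 2)
      (.seq lowSumProg
        (block (.realLoad 9 1 5) [.realLoad 10 4 1, .realMul 9 9 10, .realAdd 12 12 9,
          .natAdd 5 5 4])))
    (block (.realDiv 0 12 11) [])))

lemma evalProg_noDraw : evalProg.NoDraw := by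
  simp [evalProg, weightProg, lowSumProg, block, Prog.NoDraw]

/-- The coordinates whose estimated degree-one coefficient is at least `1 / Q` in absolute value. -/
noncomputable def selected (ex : ℕ → Cube n × ℝ) (m : ℕ) (Q : ℝ) : Finset (Fin n) :=
  open Classical in
  {i | (m : ℝ) * m ≤
    ((∑ k ∈ range m, sign ((ex k).1 i) * (ex k).2) * Q) *
      ((∑ k ∈ range m, sign ((ex k).1 i) * (ex k).2) * Q)}

/-- The signs of `x` on `J`, and `0` elsewhere. -/
noncomputable def restrictSign (J : Finset (Fin n)) (x : Cube n) (i : Fin n) : ℝ :=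
  if i ∈ J then sign (x i) else 0

/-- The part of the memory of a trained learner which evaluation only reads. -/
structure Ready (ex : ℕ → Cube n × ℝ) (d m : ℕ) (s : State) : Prop where
  dim : s.natVar 0 = n
  degree : s.natVar 1 = d
  size : s.natVar 2 = m
  one : s.natVar 4 = 1
  realOne : s.realVar 7 = 1
  realSize : s.realVar 11 = m
  label : ∀ k < m, s.realArr 1 k = (ex k).2
  point : ∀ p < m * n, s.realArr 2 p = pointEntry ex p

lemma mul_add_lt {k m i : ℕ} (hk : k < m) (hi : i < n) : k * n + i < m * n :=
  calc k * n + i < (k + 1) * n := by rw [Nat.succ_mul]; omega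
    _ ≤ m * n := Nat.mul_le_mul_right n hk

lemma Ready.point_eq {d m k i : ℕ} {s : State} (h : Ready ex d m s) (hk : k < m) (hi : i < n) :
    s.realArr 2 (k * n + i) = sign ((ex k).1 ⟨i, hi⟩) := by
  rw [h.point _ (mul_add_lt hk hi), pointEntry_eq ex k i hi]

/-- The stream `ex'` served during evaluation is irrelevant, as nothing is drawn; `ex` is the stream
the learner was trained on. -/
lemma halts_weightProg {d m : ℕ} {Q : ℝ} {s : State} (x : Cube n) (hs : Trained ex d m Q s) :
    Halts ex' weightProg (s.writePoint 0 x) (6 + n * (7 * m + 15)) fun s =>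
      Ready ex d m s ∧
      ∀ i : Fin n, s.realArr 3 i = restrictSign (selected ex m Q) x i := by
  classical
  let X : ℕ → ℝ := fun i => if h : i < n then restrictSign (selected ex m Q) x ⟨i, h⟩ else 0
  let A : ℕ → ℕ → ℝ := fun i k => if h : i < n then
    ∑ k' ∈ range k, sign ((ex k').1 ⟨i, h⟩) * (ex k').2 else 0
  let F : ℕ → State → Prop := fun i s => Ready ex d m s ∧ s.realVar 5 = Q ∧ s.realVar 6 = 0 ∧
    s.natVar 5 = i ∧ (∀ (j : ℕ) (hj : j < n), s.natArr 0 j = (x ⟨j, hj⟩).toNat) ∧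
    ∀ i' < i, s.realArr 3 i' = X i'
  let J : ℕ → ℕ → State → Prop := fun i k s => F i s ∧ s.natVar 6 = k ∧
    s.natVar 8 = k * n + i ∧ s.realVar 8 = A i k
  refine Halts.mono
    (T := 5 + (n * ((3 + ((m * (6 + 1) + 1) + (3 + ((5 + 1) + 1)))) + 1) + 1)) (Q := F n)
    (Halts.seq (R := F 0) ?_ fun s hs => Halts.loop F hs ?_ fun i hi s hs =>
      Halts.seq (R := J i 0) ?_ fun s hs => Halts.seq (R := J i m)
        (Halts.loop (J i) hs ?_ ?_) fun s hs =>
      Halts.seq (R := fun s => F i s ∧ s.realVar 8 = (A i m * Q) * (A i m * Q) ∧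
        s.realVar 9 = (m : ℝ) * m) ?_ fun s hs =>
      Halts.seq (R := fun s => F i s ∧ s.realArr 3 i = X i)
        (Halts.ifElse (fun hb => ?_) fun hb => ?_) fun s hs => ?_)
    (le_of_eq (by ring)) ?_
  · refine Halts.block _ _ _ _ (by simp [Instr.cost]) ?_
    refine ⟨⟨?_, ?_, ?_, ?_, ?_, ?_, ?_, ?_⟩, ?_, ?_, ?_, ?_, ?_⟩ <;>
      simp +contextual [Instr.exec, State.setNat, State.setReal, State.writePoint, hs.dim,
        hs.degree, hs.size, hs.threshold, hs.label, hs.point]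
  · rintro i hi s ⟨h, -, -, h5, -⟩
    rw [Test.Holds, h5, h.dim]
  · obtain ⟨h, hQ, h6, h5, hx, h3⟩ := hs
    refine Halts.block _ _ _ _ (by simp [Instr.cost]) ?_
    refine ⟨⟨⟨?_, ?_, ?_, ?_, ?_, ?_, ?_, ?_⟩, ?_, ?_, ?_, ?_, ?_⟩, ?_, ?_, ?_⟩ <;>
      simp +contextual [A, Instr.exec, State.setNat, State.setReal, h.dim, h.degree, h.size, h.one,
        h.realOne, h.realSize, h.label, h.point, hQ, h6, h5, hx, h3]
  · rintro k hk s ⟨⟨h, -⟩, h6, -⟩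
    rw [Test.Holds, h6, h.size]
  · rintro k hk s ⟨⟨h, hQ, h6, h5, hx, h3⟩, hk6, h8, hA⟩
    refine Halts.block _ _ _ _ (by simp [Instr.cost]) ?_
    refine ⟨⟨⟨?_, ?_, ?_, ?_, ?_, ?_, ?_, ?_⟩, ?_, ?_, ?_, ?_, ?_⟩, ?_, ?_, ?_⟩ <;>
      simp +contextual [Instr.exec, State.setNat, State.setReal, h.dim, h.degree, h.size, h.one,
        h.realOne, h.realSize, h.label, h.point, hQ, h6, h5, hx, h3, hk6, h8, hA]
    · ring
    · rw [h.point_eq hk hi, h.label k hk]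
      simp [A, hi, Finset.sum_range_succ]
  · obtain ⟨⟨h, hQ, h6, h5, hx, h3⟩, -, -, hA⟩ := hs
    refine Halts.block _ _ _ _ (by simp [Instr.cost]) ?_
    refine ⟨⟨⟨?_, ?_, ?_, ?_, ?_, ?_, ?_, ?_⟩, ?_, ?_, ?_, ?_, ?_⟩, ?_, ?_⟩ <;>
      simp +contextual [Instr.exec, State.setReal, h.dim, h.degree, h.size, h.one,
        h.realOne, h.realSize, h.label, h.point, hQ, h6, h5, hx, h3, hA]
  · obtain ⟨⟨h, hQ, h6, h5, hx, h3⟩, h8, h9⟩ := hs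
    rw [Test.Holds, h8, h9] at hb
    refine Halts.block _ _ _ _ (by simp [Instr.cost]) ?_
    refine ⟨⟨⟨?_, ?_, ?_, ?_, ?_, ?_, ?_, ?_⟩, ?_, ?_, ?_, ?_, ?_⟩, ?_⟩ <;>
      simp +contextual [Instr.exec, State.setNat, State.setReal, State.setRealArr,
        Function.update_apply, h.dim, h.degree, h.size, h.one,
        h.realOne, h.realSize, h.label, h.point, hQ, h6, h5, hx, h3]
    · intro i' hi' he
      omega
    · simp only [A, hi, dif_pos] at hb
      simp only [X, hi, dif_pos, restrictSign, selected, Finset.mem_filter, Finset.mem_univ,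
        true_and, if_pos hb, hx i hi]
      cases x ⟨i, hi⟩ <;> norm_num [sign]
  · obtain ⟨⟨h, hQ, h6, h5, hx, h3⟩, h8, h9⟩ := hs
    rw [Test.Holds, h8, h9] at hb
    refine Halts.block _ _ _ _ (by simp [Instr.cost]) ?_
    refine ⟨⟨⟨?_, ?_, ?_, ?_, ?_, ?_, ?_, ?_⟩, ?_, ?_, ?_, ?_, ?_⟩, ?_⟩ <;>
      simp +contextual [Instr.exec, State.setRealArr,
        Function.update_apply, h.dim, h.degree, h.size, h.one,
        h.realOne, h.realSize, h.label, h.point, hQ, h6, h5, hx, h3]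
    · intro i' hi' he
      omega
    · simp only [A, hi, dif_pos] at hb
      simp only [X, hi, dif_pos, restrictSign, selected, Finset.mem_filter, Finset.mem_univ,
        true_and, if_neg hb]
  · obtain ⟨⟨h, hQ, h6, h5, hx, h3⟩, h3'⟩ := hs
    refine Halts.block _ _ _ _ (by simp [Instr.cost]) ?_
    refine ⟨⟨?_, ?_, ?_, ?_, ?_, ?_, ?_, ?_⟩, ?_, ?_, ?_, ?_, fun i' hi' => ?_⟩
    case refine_13 =>
      rcases Nat.lt_succ_iff_lt_or_eq.1 hi' with h' | rfl
      · exact h3 i' h'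
      · exact h3'
    all_goals
      simp +contextual [Instr.exec, State.setNat, h.dim, h.degree, h.size, h.one,
        h.realOne, h.realSize, h.label, h.point, hQ, h6, h5, hx]
  · rintro s ⟨h, -, -, -, -, h3⟩
    exact ⟨h, fun i => by simp [h3 i i.2, X]⟩

/-- The variables of the low-degree kernel at `x` and example `k`. -/
noncomputable def kernelVar (ex : ℕ → Cube n × ℝ) (J : Finset (Fin n)) (x : Cube n) (k : ℕ)
    (i : Fin n) : ℝ :=
  restrictSign J x i * sign ((ex k).1 i)

lemma halts_lowSumProg {d m k : ℕ} {v : ℝ} {J : Finset (Fin n)} {s : State} (x : Cube n)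
    (hs : Ready ex d m s) (hk : k < m) (h3 : s.natVar 3 = 0) (h5 : s.natVar 5 = k)
    (h8 : s.natVar 8 = k * n) (hv : s.realVar 12 = v)
    (hx : ∀ i : Fin n, s.realArr 3 i = restrictSign J x i) :
    Halts ex' lowSumProg s (7 + 3 * d + n * (8 * d + 8)) fun s =>
      Ready ex d m s ∧ s.natVar 3 = 0 ∧ s.natVar 5 = k ∧ s.natVar 8 = (k + 1) * n ∧
      s.realVar 12 = v ∧ (∀ i : Fin n, s.realArr 3 i = restrictSign J x i) ∧
      s.realArr 4 d = lowSum (kernelVar ex J x k) univ d := by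
  classical
  let u := kernelVar ex J x k
  let U : ℕ → Finset (Fin n) := fun i => {i' | i'.val < i}
  have hU : ∀ (i : ℕ) (hi : i < n), U (i + 1) = insert ⟨i, hi⟩ (U i) := by
    intro i hi
    ext i'
    simp only [U, Finset.mem_filter, Finset.mem_univ, true_and, Finset.mem_insert, Fin.ext_iff]
    omega
  let F : State → Prop := fun s => Ready ex d m s ∧ s.natVar 3 = 0 ∧ s.natVar 5 = k ∧
    s.realVar 12 = v ∧ ∀ i : Fin n, s.realArr 3 i = restrictSign J x i
  let I : ℕ → State → Prop := fun j s => F s ∧ s.natVar 8 = k * n ∧ s.natVar 7 = j ∧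
    ∀ j' < j, s.realArr 4 j' = 1
  let G : ℕ → State → Prop := fun i s => F s ∧ s.natVar 6 = i ∧ s.natVar 8 = k * n + i ∧
    ∀ j ≤ d, s.realArr 4 j = lowSum u (U i) j
  let H : ∀ i : ℕ, i < n → ℕ → State → Prop := fun i hi r s => F s ∧ s.natVar 6 = i ∧
    s.natVar 8 = k * n + i ∧ s.natVar 7 = d - r ∧ s.realVar 9 = u ⟨i, hi⟩ ∧
    ∀ j ≤ d, s.realArr 4 j = if d - r < j then lowSum u (U (i + 1)) j else lowSum u (U i) j
  refine Halts.mono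
    (T := 1 + (((d + 1) * (2 + 1) + 1) + (1 + (n * ((4 + ((d * (7 + 1) + 1) + 2)) + 1) + 1))))
    (Q := G n)
    (Halts.seq (R := I 0) ?_ fun s hs => Halts.seq (R := I (d + 1)) (Halts.loop I hs ?_ ?_)
      fun s hs => Halts.seq (R := G 0) ?_ fun s hs => Halts.loop G hs ?_ fun i hi s hs =>
      Halts.seq (R := H i hi 0) ?_ fun s hs => Halts.seq (R := H i hi d)
        (Halts.loop (H i hi) hs ?_ ?_) fun s hs => ?_) (le_of_eq (by ring)) ?_
  · refine Halts.block _ _ _ _ (by simp [Instr.cost]) ?_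
    refine ⟨⟨⟨?_, ?_, ?_, ?_, ?_, ?_, ?_, ?_⟩, ?_, ?_, ?_, ?_⟩, ?_, ?_, ?_⟩ <;>
      simp +contextual [Instr.exec, State.setNat, hs.dim, hs.degree, hs.size, hs.one, hs.realOne,
        hs.realSize, hs.label, hs.point, h3, h5, h8, hv, hx]
  · rintro j hj s ⟨⟨h, -⟩, -, h7, -⟩
    rw [Test.Holds, h7, h.degree]
    omega
  · rintro j hj s ⟨⟨h, h3, h5, hv, hx⟩, h8, h7, h4⟩
    refine Halts.block _ _ _ _ (by simp [Instr.cost]) ?_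
    refine ⟨⟨⟨?_, ?_, ?_, ?_, ?_, ?_, ?_, ?_⟩, ?_, ?_, ?_, ?_⟩, ?_, ?_, ?_⟩ <;>
      simp +contextual [Instr.exec, State.setNat, State.setRealArr, Function.update_apply, h.dim,
        h.degree, h.size, h.one, h.realOne, h.realSize, h.label, h.point, h3, h5, h8, hv, hx, h7]
    intro j' hj' hne
    exact h4 j' (by omega)
  · obtain ⟨⟨h, h3, h5, hv, hx⟩, h8, h7, h4⟩ := hs
    refine Halts.block _ _ _ _ (by simp [Instr.cost]) ?_
    refine ⟨⟨⟨?_, ?_, ?_, ?_, ?_, ?_, ?_, ?_⟩, ?_, ?_, ?_, ?_⟩, ?_, ?_, ?_⟩ <;>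
      simp +contextual [Instr.exec, State.setNat, h.dim, h.degree, h.size, h.one, h.realOne,
        h.realSize, h.label, h.point, h3, h5, h8, hv, hx, U, lowSum_empty]
    exact fun j hj => h4 j (by omega)
  · rintro i hi s ⟨⟨h, -⟩, h6, -⟩
    rw [Test.Holds, h6, h.dim]
  · obtain ⟨⟨h, h3, h5, hv, hx⟩, h6, h8, h4⟩ := hs
    refine Halts.block _ _ _ _ (by simp [Instr.cost]) ?_
    refine ⟨⟨⟨?_, ?_, ?_, ?_, ?_, ?_, ?_, ?_⟩, ?_, ?_, ?_, ?_⟩, ?_, ?_, ?_, ?_, ?_⟩ <;>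
      simp +contextual [Instr.exec, State.setNat, State.setReal, h.dim, h.degree, h.size, h.one,
        h.realOne, h.realSize, h.label, h.point, h3, h5, h8, hv, hx, h6, h4]
    rw [h.point_eq hk hi, hx ⟨i, hi⟩]
    rfl
  · rintro r hr s ⟨⟨-, h3, -⟩, -, -, h7, -⟩
    rw [Test.Holds, h7, h3]
    omega
  · rintro r hr s ⟨⟨h, h3, h5, hv, hx⟩, h6, h8, h7, h9, h4⟩
    refine Halts.block _ _ _ _ (by simp [Instr.cost]) ?_
    refine ⟨⟨⟨?_, ?_, ?_, ?_, ?_, ?_, ?_, ?_⟩, ?_, ?_, ?_, ?_⟩, ?_, ?_, ?_, ?_, ?_⟩ <;>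
      simp +contextual [Instr.exec, State.setNat, State.setReal, State.setRealArr,
        Function.update_apply, h.dim, h.degree, h.size, h.one,
        h.realOne, h.realSize, h.label, h.point, h3, h5, h8, hv, hx, h6, h7, h9]
    · omega
    · obtain ⟨e, he⟩ : ∃ e, d - r = e + 1 := ⟨d - r - 1, by omega⟩
      have he' : d - (r + 1) = e := by omega
      intro j hj
      rw [he, he', Nat.add_sub_cancel, h4 j hj, h4 (e + 1) (by omega), h4 e (by omega), he,
        if_neg (lt_irrefl _), if_neg (by omega : ¬ e + 1 < e)]
      rcases lt_trichotomy j (e + 1) with hlt | rfl | hlt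
      · rw [if_neg (by omega), if_neg (by omega), if_neg (by omega)]
      · rw [if_pos rfl, if_pos (by omega), hU i hi, lowSum_insert_succ _ (by simp [U])]
      · rw [if_neg (by omega), if_pos (by omega), if_pos (by omega)]
  · obtain ⟨⟨h, h3, h5, hv, hx⟩, h6, h8, h7, h9, h4⟩ := hs
    refine Halts.block _ _ _ _ (by simp [Instr.cost]) ?_
    refine ⟨⟨⟨?_, ?_, ?_, ?_, ?_, ?_, ?_, ?_⟩, ?_, ?_, ?_, ?_⟩, ?_, ?_, ?_⟩ <;>
      simp +contextual [Instr.exec, State.setNat, h.dim, h.degree, h.size, h.one, h.realOne,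
        h.realSize, h.label, h.point, h3, h5, h8, hv, hx, h6, h4]
    · ring
    · intro j hj h0
      subst h0
      rw [lowSum_zero, lowSum_zero]
  · rintro s ⟨⟨h, h3, h5, hv, hx⟩, h6, h8, h4⟩
    refine ⟨h, h3, h5, by rw [h8]; ring, hv, hx, ?_⟩
    rw [h4 d le_rfl]
    congr 1
    ext i
    simp [U]

/-- The hypothesis computed from the examples: the average of the labels, weighted by the
low-degree kernel on the selected coordinates. -/
noncomputable def hypothesis (ex : ℕ → Cube n × ℝ) (d m : ℕ) (Q : ℝ) (x : Cube n) : ℝ :=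
  (∑ k ∈ range m, (ex k).2 * lowSum (kernelVar ex (selected ex m Q) x k) univ d) / m

lemma halts_evalProg {d m : ℕ} {Q : ℝ} {s : State} (x : Cube n) (hs : Trained ex d m Q s) :
    Halts ex' evalProg (s.writePoint 0 x)
      (12 + n * (7 * m + 15) + m * (13 + 3 * d + n * (8 * d + 8))) fun s =>
      s.realVar 0 = hypothesis ex d m Q x := by
  classical
  let J := selected ex m Q
  let V : ℕ → ℝ := fun k => ∑ k' ∈ range k, (ex k').2 * lowSum (kernelVar ex J x k') univ d
  let I : ℕ → State → Prop := fun k s => Ready ex d m s ∧ s.natVar 3 = 0 ∧ s.natVar 5 = k ∧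
    s.natVar 8 = k * n ∧ s.realVar 12 = V k ∧
    ∀ i : Fin n, s.realArr 3 i = restrictSign J x i
  refine Halts.mono
    (T := 6 + n * (7 * m + 15) +
      (4 + ((m * ((7 + 3 * d + n * (8 * d + 8) + 5) + 1) + 1) + 1)))
    (Halts.seq (halts_weightProg x hs) fun s hs => Halts.seq (R := I 0) ?_ fun s hs =>
      Halts.seq (R := I m) (Halts.loop I hs ?_ fun k hk s hs =>
        Halts.seq (halts_lowSumProg x hs.1 hk hs.2.1 hs.2.2.1 hs.2.2.2.1 hs.2.2.2.2.1
          hs.2.2.2.2.2) fun s hs => ?_) fun s hs => ?_) (le_of_eq (by ring)) fun _ h => h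
  · obtain ⟨h, hx⟩ := hs
    refine Halts.block _ _ _ _ (by simp [Instr.cost]) ?_
    refine ⟨⟨?_, ?_, ?_, ?_, ?_, ?_, ?_, ?_⟩, ?_, ?_, ?_, ?_, ?_⟩ <;>
      simp +contextual [Instr.exec, State.setNat, State.setReal, h.dim, h.degree, h.size, h.one,
        h.realOne, h.realSize, h.label, h.point, hx, V, J]
  · rintro k hk s ⟨h, -, h5, -⟩
    rw [Test.Holds, h5, h.size]
  · obtain ⟨h, h3, h5, h8, hv, hx, h4⟩ := hs
    refine Halts.block _ _ _ _ (by simp [Instr.cost]) ?_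
    refine ⟨⟨?_, ?_, ?_, ?_, ?_, ?_, ?_, ?_⟩, ?_, ?_, ?_, ?_, ?_⟩ <;>
      simp +contextual [Instr.exec, State.setNat, State.setReal, h.dim, h.degree, h.size, h.one,
        h.realOne, h.realSize, h.label, h.point, hx, h3, h5, h8, hv, h4]
    simp [V, Finset.sum_range_succ, h.label k hk]
  · obtain ⟨h, h3, h5, h8, hv, hx⟩ := hs
    refine Halts.block _ _ _ _ (by simp [Instr.cost]) ?_
    simp [Instr.exec, State.setReal, hv, h.realSize, hypothesis, V, J]

end Programs

/-! ### Accuracy of the hypothesis -/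

lemma lowSum_kernelVar (f : Cube n → ℝ) (ω : ℕ → Cube n) (J : Finset (Fin n)) (x : Cube n)
    (k d : ℕ) : lowSum (kernelVar (examples f ω) J x k) univ d =
      ∑ S ∈ lowSets J d, chi S x * chi S (ω k) := by
  classical
  symm
  refine Finset.sum_subset_zero_on_sdiff (fun S hS => ?_) (fun S hS => ?_) fun S hS => ?_
  · exact mem_lowSets.2 ⟨Finset.subset_univ S, (mem_lowSets.1 hS).2⟩
  · rw [Finset.mem_sdiff, mem_lowSets, mem_lowSets] at hS
    obtain ⟨i, hi, hiJ⟩ := Finset.not_subset.1 fun h => hS.2 ⟨h, hS.1.2⟩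
    exact Finset.prod_eq_zero hi (by simp [kernelVar, restrictSign, hiJ])
  · rw [chi, chi, ← Finset.prod_mul_distrib]
    refine Finset.prod_congr rfl fun i hi => ?_
    rw [kernelVar, restrictSign, if_pos ((mem_lowSets.1 hS).1 hi), examples]

/-- The empirical Fourier coefficient of `f` at `S` over `m` examples. -/
noncomputable def empirical (f : Cube n → ℝ) (ω : ℕ → Cube n) (m : ℕ) (S : Finset (Fin n)) : ℝ :=
  (∑ k ∈ range m, f (ω k) * chi S (ω k)) / m

lemma hypothesis_eq (f : Cube n → ℝ) (ω : ℕ → Cube n) (d m : ℕ) (Q : ℝ) (x : Cube n) :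
    hypothesis (examples f ω) d m Q x =
      ∑ S ∈ lowSets (selected (examples f ω) m Q) d, empirical f ω m S * chi S x := by
  simp only [hypothesis, lowSum_kernelVar, empirical, div_mul_eq_mul_div, ← Finset.sum_div]
  congr 1
  simp only [Finset.mul_sum, Finset.sum_mul]
  rw [Finset.sum_comm]
  refine Finset.sum_congr rfl fun S _ => Finset.sum_congr rfl fun k _ => ?_
  simp only [examples]
  ring

lemma mem_selected {f : Cube n → ℝ} {ω : ℕ → Cube n} {m : ℕ} (hm : 0 < m) {Q : ℝ} (hQ : 0 < Q)
    {i : Fin n} : i ∈ selected (examples f ω) m Q ↔ 1 / Q ≤ |empirical f ω m {i}| := by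
  have hm' : (0 : ℝ) < m := by exact_mod_cast hm
  have h : ∑ k ∈ range m, sign ((examples f ω k).1 i) * (examples f ω k).2 =
      m * empirical f ω m {i} := by
    rw [empirical, mul_div_cancel₀ _ hm'.ne']
    exact Finset.sum_congr rfl fun k _ => by simp [examples, chi, mul_comm]
  rw [selected, Finset.mem_filter, h, ← abs_le_iff_mul_self_le, abs_of_pos hm', abs_mul,
    abs_mul, abs_of_pos hm', abs_of_pos hQ, mul_assoc, le_mul_iff_one_le_right hm', div_le_iff₀ hQ]
  simp

lemma le_degree_mul {a ε : ℝ} (hε : 0 < ε) : 12 * a ≤ degree a ε * ε ^ 2 :=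
  not_lt.1 fun h => lt_irrefl _ ((lt_degree_iff hε (one_le_degree a ε)).2 h)

lemma div_two_pow_degree_le {a ε : ℝ} (hε : 0 < ε) : a / 2 ^ degree a ε ≤ ε ^ 2 / 12 := by
  have h1 := le_degree_mul (a := a) hε
  have h2 : (degree a ε : ℝ) ≤ 2 ^ degree a ε := by exact_mod_cast Nat.lt_two_pow_self.le
  rw [div_le_div_iff₀ (by positivity) (by norm_num)]
  nlinarith [sq_nonneg ε]

lemma div_degree_add_one_le {a ε : ℝ} (hε : 0 < ε) :
    a / ((degree a ε : ℝ) + 1) ≤ ε ^ 2 / 12 := by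
  have h1 := le_degree_mul (a := a) hε
  rw [div_le_div_iff₀ (by positivity) (by norm_num)]
  nlinarith [sq_nonneg ε]

lemma unateClass_nonneg {f : Cube n → ℝ} {a : ℝ} (hf : f ∈ unateClass n a) : 0 ≤ a :=
  (totalInfluence_nonneg f).trans hf.2.2

lemma sum_compl_lowSets_degree_le {f : Cube n → ℝ} {a ε : ℝ} (hf : f ∈ unateClass n a)
    (hε : 0 < ε) {J : Finset (Fin n)}
    (hJ : ∀ i ∉ J, influence f i ≤ (1 / 36) ^ degree a ε) :
    ∑ S ∈ (lowSets J (degree a ε))ᶜ, fourier f S ^ 2 ≤ ε ^ 2 / 6 := by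
  have h := sum_compl_lowSets_le hf.2.1 (J := J) (d := degree a ε)
    (η := (1 / 6) ^ degree a ε) (by positivity) fun i hi => by
      rw [← pow_mul, mul_comm, pow_mul]
      norm_num
      simpa using hJ i hi
  have h1 := div_degree_add_one_le (a := a) hε
  have h2 := div_two_pow_degree_le (a := a) hε
  have h3 : totalInfluence f / ((degree a ε : ℝ) + 1) ≤ a / ((degree a ε : ℝ) + 1) :=
    div_le_div_of_nonneg_right hf.2.2 (by positivity)
  have h4 : (3 : ℝ) ^ degree a ε * (1 / 6) ^ degree a ε * totalInfluence f ≤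
      a / 2 ^ degree a ε := by
    rw [← mul_pow, show (3 : ℝ) * (1 / 6) = 1 / 2 by norm_num, one_div, inv_pow, ← div_eq_inv_mul]
    exact div_le_div_of_nonneg_right hf.2.2 (by positivity)
  linarith

/-- In the degenerate case the target has small variance: either its total influence is small
compared to `ε ^ 2`, or no variable is influential, so that the low-degree weight is small, too. -/
lemma sum_compl_lowSets_empty_le {f : Cube n → ℝ} {a ε : ℝ} (hf : f ∈ unateClass n a) (hε : 0 < ε)
    (h : 12 * a ≤ ε ^ 2 ∨ a * 72 ^ degree a ε ≤ 1) :
    ∑ S ∈ (lowSets (∅ : Finset (Fin n)) 0)ᶜ, fourier f S ^ 2 ≤ ε ^ 2 / 6 := by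
  rcases h with h | h
  · have hl : lowSets (∅ : Finset (Fin n)) 0 = lowSets univ 0 := by
      ext S
      simp +contextual [mem_lowSets]
    rw [hl]
    have h1 := sum_compl_lowSets_le hf.2.1 (J := univ) (d := 0) le_rfl (by simp)
    have h2 := hf.2.2
    norm_num at h1
    nlinarith [sq_nonneg ε]
  · have hl : lowSets (∅ : Finset (Fin n)) 0 = lowSets ∅ (degree a ε) := by
      ext S
      simp +contextual [mem_lowSets, Finset.subset_empty]
    rw [hl]
    refine sum_compl_lowSets_degree_le hf hε fun i _ => ?_
    have h1 : influence f i ≤ totalInfluence f :=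
      Finset.single_le_sum (fun j _ => influence_nonneg f j) (Finset.mem_univ i)
    have h2 : a ≤ (1 / 72) ^ degree a ε := by
      rw [one_div, inv_pow, ← one_div, le_div_iff₀ (by positivity)]
      exact h
    refine (h1.trans hf.2.2).trans (h2.trans ?_)
    exact pow_le_pow_left₀ (by norm_num) (by norm_num) _

/-- Accurate estimates of the Fourier coefficients up to the degree make the hypothesis accurate:
the selected coordinates contain all the influential ones, and they are few, so that the errors of
the estimates add up to little. -/
lemma expect_sq_sub_hypothesis_le {f : Cube n → ℝ} {a ε : ℝ} (hf : f ∈ unateClass n a) (hε : 0 < ε)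
    (h : 1 < a * 72 ^ degree a ε) {m : ℕ} (hm : 0 < m) {ω : ℕ → Cube n}
    (hω : ∀ S ∈ lowSets univ (degree a ε),
      |empirical f ω m S - fourier f S| ≤ (1 / 2) ^ (12 * degree a ε ^ 2)) :
    𝔼 x, (f x - hypothesis (examples f ω) (degree a ε) m (72 ^ degree a ε) x) ^ 2 ≤ ε ^ 2 := by
  classical
  set d := degree a ε with hd
  have hd1 : 1 ≤ d := one_le_degree a ε
  set J := selected (examples f ω) m (72 ^ d) with hJ
  set δ : ℝ := (1 / 2) ^ (12 * d ^ 2) with hδ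
  have hδ0 : 0 ≤ δ := by positivity
  have hdd : d ≤ d ^ 2 := by nlinarith
  have hpow2 : (2 : ℝ) ≤ 2 ^ d := by
    calc (2 : ℝ) = 2 ^ 1 := by norm_num
      _ ≤ 2 ^ d := pow_le_pow_right₀ (by norm_num) hd1
  have hδd : δ ≤ (1 / 72) ^ d / 2 := by
    have h1 : δ ≤ (1 / 2) ^ (12 * d) :=
      pow_le_pow_of_le_one (by norm_num) (by norm_num) (by omega)
    have h2 : ((1 : ℝ) / 2) ^ (12 * d) ≤ (1 / 72) ^ d * (1 / 2) ^ d := by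
      rw [pow_mul, ← mul_pow]
      exact pow_le_pow_left₀ (by norm_num) (by norm_num) _
    have h3 : ((1 : ℝ) / 2) ^ d ≤ 1 / 2 := pow_le_of_le_one (by norm_num) (by norm_num) (by omega)
    have h4 : (0 : ℝ) < (1 / 72) ^ d := by positivity
    nlinarith
  have hsing : ∀ i, |empirical f ω m {i} - fourier f {i}| ≤ δ := fun i =>
    hω _ (mem_lowSets.2 ⟨Finset.subset_univ _, by simpa using hd1⟩)
  have hmem : ∀ i, i ∈ J ↔ (1 / 72) ^ d ≤ |empirical f ω m {i}| := fun i => by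
    rw [hJ, mem_selected hm (by positivity), one_div_pow]
  have hout : ∀ i ∉ J, influence f i ≤ (1 / 36) ^ d := by
    intro i hi
    rw [hmem, not_le] at hi
    rw [← abs_fourier_singleton hf.1]
    have h1 := abs_sub_abs_le_abs_sub (fourier f {i}) (empirical f ω m {i})
    rw [abs_sub_comm] at h1
    have h2 := hsing i
    have h3 : (2 : ℝ) * (1 / 72) ^ d ≤ (1 / 36) ^ d := by
      rw [show (1 : ℝ) / 36 = 2 * (1 / 72) by norm_num, mul_pow]
      exact mul_le_mul_of_nonneg_right hpow2 (by positivity)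
    have h4 : (0 : ℝ) < (1 / 72) ^ d := by positivity
    linarith
  have hin : ∀ i ∈ J, ((1 / 72) ^ d / 2) ^ 2 ≤ fourier f {i} ^ 2 := by
    intro i hi
    rw [hmem] at hi
    have h1 := abs_sub_abs_le_abs_sub (empirical f ω m {i}) (fourier f {i})
    have h2 := hsing i
    rw [← sq_abs (fourier f {i})]
    exact pow_le_pow_left₀ (by positivity) (by linarith) 2
  have hcardJ : (#J : ℝ) * ((1 / 72) ^ d / 2) ^ 2 ≤ 1 := by
    calc (#J : ℝ) * ((1 / 72) ^ d / 2) ^ 2 ≤ ∑ i ∈ J, fourier f {i} ^ 2 := by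
          rw [← nsmul_eq_mul, ← Finset.sum_const]
          exact Finset.sum_le_sum hin
      _ = ∑ S ∈ J.map ⟨fun i => {i}, Finset.singleton_injective⟩, fourier f S ^ 2 := by
          rw [Finset.sum_map]
          rfl
      _ ≤ 𝔼 x, f x ^ 2 := sum_fourier_sq_le _ _
      _ ≤ 1 := Finset.expect_le Finset.univ_nonempty fun x _ =>
          pow_le_one₀ (hf.2.1 x).1 (hf.2.1 x).2
  have hcardJ' : ((#J + 1 : ℕ) : ℝ) ≤ 2 ^ (15 * d) := by
    have h1 : (#J : ℝ) ≤ 4 * 5184 ^ d := by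
      have h2 : ((1 / 72 : ℝ) ^ d / 2) ^ 2 = 1 / (4 * 5184 ^ d) := by
        rw [div_pow, ← pow_mul, mul_comm d 2, pow_mul, one_div_pow, one_div_pow]
        norm_num
        ring
      rw [h2, mul_one_div, div_le_one (by positivity)] at hcardJ
      exact hcardJ
    have h3 : (1 : ℝ) ≤ 5184 ^ d := one_le_pow₀ (by norm_num)
    have h4 : (5 : ℝ) ≤ 5 ^ d := by
      calc (5 : ℝ) = 5 ^ 1 := by norm_num
        _ ≤ 5 ^ d := pow_le_pow_right₀ (by norm_num) hd1
    calc ((#J + 1 : ℕ) : ℝ) ≤ 5 * 5184 ^ d := by push_cast; linarith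
      _ ≤ 5 ^ d * 5184 ^ d := mul_le_mul_of_nonneg_right h4 (by positivity)
      _ = (5 * 5184) ^ d := (mul_pow _ _ _).symm
      _ ≤ (2 ^ 15) ^ d := pow_le_pow_left₀ (by norm_num) (by norm_num) _
      _ = 2 ^ (15 * d) := (pow_mul _ _ _).symm
  have hcard : (#(lowSets J d) : ℝ) ≤ 2 ^ (15 * d ^ 2) := by
    calc (#(lowSets J d) : ℝ) ≤ ((#J + 1 : ℕ) : ℝ) ^ d := by exact_mod_cast card_lowSets_le J d
      _ ≤ (2 ^ (15 * d)) ^ d := pow_le_pow_left₀ (by positivity) hcardJ' _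
      _ = 2 ^ (15 * d ^ 2) := by rw [← pow_mul]; ring_nf
  have hest : ∑ S ∈ lowSets J d, (fourier f S - empirical f ω m S) ^ 2 ≤ ε ^ 2 / 12 := by
    calc ∑ S ∈ lowSets J d, (fourier f S - empirical f ω m S) ^ 2
        ≤ ∑ S ∈ lowSets J d, δ ^ 2 := by
          refine Finset.sum_le_sum fun S hS => ?_
          rw [← sq_abs, abs_sub_comm]
          exact pow_le_pow_left₀ (abs_nonneg _)
            (hω S (mem_lowSets.2 ⟨Finset.subset_univ _, (mem_lowSets.1 hS).2⟩)) 2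
      _ = #(lowSets J d) * δ ^ 2 := by rw [Finset.sum_const, nsmul_eq_mul]
      _ ≤ 2 ^ (15 * d ^ 2) * δ ^ 2 := mul_le_mul_of_nonneg_right hcard (sq_nonneg _)
      _ = (1 / 2) ^ (9 * d ^ 2) := by
          rw [hδ, ← pow_mul, show 12 * d ^ 2 * 2 = 15 * d ^ 2 + 9 * d ^ 2 by ring, pow_add,
            ← mul_assoc, ← mul_pow]
          norm_num
      _ ≤ (1 / 2) ^ (9 * d) := pow_le_pow_of_le_one (by norm_num) (by norm_num) (by omega)
      _ ≤ (1 / 72) ^ d * (1 / 2) ^ d := by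
          rw [pow_mul, ← mul_pow]
          exact pow_le_pow_left₀ (by norm_num) (by norm_num) _
      _ ≤ a * (1 / 2) ^ d := by
          refine mul_le_mul_of_nonneg_right ?_ (by positivity)
          rw [one_div_pow, div_le_iff₀ (by positivity)]
          exact h.le
      _ = a / 2 ^ d := by rw [one_div_pow, mul_one_div]
      _ ≤ ε ^ 2 / 12 := div_two_pow_degree_le hε
  have htail := sum_compl_lowSets_degree_le hf hε hout
  simp only [hypothesis_eq]
  rw [expect_sq_sub_sum_chi]
  linarith [sq_nonneg ε]

/-- The failure probability of Hoeffding's inequality with a union bound over the at most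
`(n + 1) ^ d` sets of at most `d` coordinates. -/
lemma add_one_pow_mul_exp_le {d : ℕ} (hn : 2 ≤ n) (hd : 1 ≤ d) :
    ((n : ℝ) + 1) ^ d * (2 * Real.exp (-(((Nat.clog 2 n * 2 ^ (32 * d ^ 2) : ℕ) : ℝ) *
      ((1 / 2) ^ (12 * d ^ 2)) ^ 2 / 2))) ≤ 1 / 3 := by
  set L := Nat.clog 2 n with hL
  have hL1 : 1 ≤ L := Nat.clog_pos (by norm_num) hn
  have hnL : n ≤ 2 ^ L := Nat.le_pow_clog (by norm_num) n
  have hLd : 1 ≤ L * d := Nat.mul_pos hL1 hd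
  have h1 : (((L * 2 ^ (32 * d ^ 2) : ℕ) : ℝ) * ((1 / 2) ^ (12 * d ^ 2)) ^ 2 / 2) =
      L * 2 ^ (8 * d ^ 2) / 2 := by
    push_cast
    rw [← pow_mul, show 12 * d ^ 2 * 2 = 24 * d ^ 2 by ring,
      show 32 * d ^ 2 = 8 * d ^ 2 + 24 * d ^ 2 by ring, pow_add, one_div_pow]
    field_simp
  have h2 : ((5 * (L * d) : ℕ) : ℝ) ≤ L * 2 ^ (8 * d ^ 2) / 2 := by
    have h3 : 10 * d ≤ 2 ^ (8 * d ^ 2) := by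
      calc 10 * d ≤ 10 ^ d * 2 ^ d :=
            Nat.mul_le_mul (Nat.le_self_pow (by omega) 10) Nat.lt_two_pow_self.le
        _ = 20 ^ d := by rw [← Nat.mul_pow]
        _ ≤ (2 ^ 8) ^ d := Nat.pow_le_pow_left (by norm_num) d
        _ = 2 ^ (8 * d) := (pow_mul _ _ _).symm
        _ ≤ 2 ^ (8 * d ^ 2) := Nat.pow_le_pow_right (by norm_num) (by nlinarith)
    have h4 : (10 * d : ℝ) ≤ 2 ^ (8 * d ^ 2) := by exact_mod_cast h3
    push_cast
    nlinarith [Nat.cast_nonneg (α := ℝ) L]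
  have h5 : Real.exp (-(L * 2 ^ (8 * d ^ 2) / 2)) ≤ 1 / 2 ^ (5 * (L * d)) := by
    rw [Real.exp_neg, ← one_div]
    refine one_div_le_one_div_of_le (by positivity) ?_
    calc (2 : ℝ) ^ (5 * (L * d)) ≤ Real.exp 1 ^ (5 * (L * d)) :=
          pow_le_pow_left₀ (by norm_num) (by linarith [Real.add_one_le_exp 1]) _
      _ = Real.exp ((5 * (L * d) : ℕ) : ℝ) := by rw [← Real.exp_nat_mul, mul_one]
      _ ≤ _ := Real.exp_le_exp.2 h2
  have h6 : ((n : ℝ) + 1) ^ d ≤ 2 ^ (2 * (L * d)) := by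
    have h7 : n + 1 ≤ 2 ^ (2 * L) := by
      calc n + 1 ≤ 2 ^ L * 2 ^ L := by nlinarith [Nat.one_lt_two_pow (n := L) (by omega)]
        _ = 2 ^ (2 * L) := by rw [← pow_add]; ring_nf
    calc ((n : ℝ) + 1) ^ d ≤ (2 ^ (2 * L)) ^ d :=
          pow_le_pow_left₀ (by positivity) (by exact_mod_cast h7) d
      _ = 2 ^ (2 * (L * d)) := by rw [← pow_mul]; ring_nf
  rw [h1]
  calc ((n : ℝ) + 1) ^ d * (2 * Real.exp (-(L * 2 ^ (8 * d ^ 2) / 2)))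
      ≤ 2 ^ (2 * (L * d)) * (2 * (1 / 2 ^ (5 * (L * d)))) := by gcongr
    _ = 2 * (1 / 2 ^ (3 * (L * d))) := by
        rw [show 5 * (L * d) = 2 * (L * d) + 3 * (L * d) by ring, pow_add]
        field_simp
    _ ≤ 2 * (1 / 2 ^ (3 * 1)) := by
        refine mul_le_mul_of_nonneg_left (one_div_le_one_div_of_le (by norm_num) ?_) (by norm_num)
        exact pow_le_pow_right₀ (by norm_num) (by omega)
    _ ≤ 1 / 3 := by norm_num

/-- With probability at least `2 / 3` the hypothesis is accurate. -/
lemma two_thirds_le_measureReal {f : Cube n → ℝ} {a ε : ℝ} (hn : 2 ≤ n) (hf : f ∈ unateClass n a)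
    (hε : 0 < ε) :
    2 / 3 ≤ (uniformSeq n).real {ω | 𝔼 x, (f x - hypothesis (examples f ω) (parameters n a ε).1
      (parameters n a ε).2 (72 ^ degree a ε) x) ^ 2 ≤ ε ^ 2} := by
  by_cases h : 12 * a ≤ ε ^ 2 ∨ a * 72 ^ degree a ε ≤ 1
  · have hp : parameters n a ε = (0, 1) := if_pos h
    have hh : ∀ ω x, hypothesis (examples f ω) 0 1 (72 ^ degree a ε) x = f (ω 0) := by
      intro ω x
      simp [hypothesis, lowSum_zero, examples]
    simp only [hp, hh]
    exact le_measureReal_constant hε (sum_compl_lowSets_empty_le hf hε h)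
  · have hp : parameters n a ε = (degree a ε, Nat.clog 2 n * 2 ^ (32 * degree a ε ^ 2)) :=
      if_neg h
    simp only [hp]
    rw [not_or, not_le, not_le] at h
    set m := Nat.clog 2 n * 2 ^ (32 * degree a ε ^ 2) with hm
    have hm0 : 0 < m := Nat.mul_pos (Nat.clog_pos (by norm_num) hn) (by positivity)
    have hm0' : (0 : ℝ) < m := by exact_mod_cast hm0
    have hcard : (#(lowSets (univ : Finset (Fin n)) (degree a ε)) : ℝ) ≤
        ((n : ℝ) + 1) ^ degree a ε := by
      have := card_lowSets_le (univ : Finset (Fin n)) (degree a ε)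
      rw [Finset.card_fin] at this
      exact_mod_cast this
    have h1 := le_measureReal_fourier_estimates (f := f)
      (fun x => abs_le.2 ⟨by linarith [(hf.2.1 x).1], (hf.2.1 x).2⟩)
      (lowSets univ (degree a ε)) m (δ := (1 / 2) ^ (12 * degree a ε ^ 2)) (by positivity)
    have h2 := add_one_pow_mul_exp_le hn (one_le_degree a ε)
    rw [← hm] at h2
    have h3 : (#(lowSets (univ : Finset (Fin n)) (degree a ε)) : ℝ) *
        (2 * Real.exp (-(m * ((1 / 2) ^ (12 * degree a ε ^ 2)) ^ 2 / 2))) ≤ 1 / 3 :=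
      (mul_le_mul_of_nonneg_right hcard (by positivity)).trans h2
    refine le_trans (by linarith) (h1.trans (MeasureTheory.measureReal_mono ?_))
    intro ω hω
    refine expect_sq_sub_hypothesis_le hf hε h.2 hm0 fun S hS => ?_
    have h4 := hω S hS
    rw [empirical, div_sub' hm0'.ne', abs_div, abs_of_pos hm0', div_le_iff₀ hm0', mul_comm _ (m : ℝ)]
    exact h4

/-! ### Resource bounds -/

/-- The resources of the learner in terms of `B = 2 ^ (19008 * (a / ε ^ 2) ^ 2)`. In the
non-degenerate case `12 * a > ε ^ 2`, so that rounding in the degree is harmless. -/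
lemma parameter_bounds {a ε : ℝ} (hn : 2 ≤ n) (ha : 0 ≤ a) (hε : 0 < ε) :
    (degree a ε : ℝ) ≤ 2 * 2 ^ (19008 * (a ^ 2 / ε ^ 4)) ∧
    ((parameters n a ε).1 : ℝ) ^ 2 ≤ 2 ^ (19008 * (a ^ 2 / ε ^ 4)) ∧
    ((parameters n a ε).2 : ℝ) ≤ Real.logb 2 n * 2 ^ (19008 * (a ^ 2 / ε ^ 4)) ∧
    (Nat.clog 2 n : ℝ) ≤ 2 * Real.logb 2 n ∧ 1 ≤ Real.logb 2 n := by
  have hlog : 1 ≤ Real.logb 2 n := by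
    rw [Real.le_logb_iff_rpow_le (by norm_num) (by positivity), Real.rpow_one]
    exact_mod_cast hn
  have hclog : (Nat.clog 2 n : ℝ) ≤ 2 * Real.logb 2 n := by
    have h := Real.natCeil_logb_natCast 2 n
    have h1 := Nat.ceil_lt_add_one (a := Real.logb ((2 : ℕ) : ℝ) n) (by
      push_cast
      linarith)
    rw [h] at h1
    push_cast at h1
    linarith
  set x := a / ε ^ 2 with hx
  have hx0 : 0 ≤ x := by positivity
  have hx2 : a ^ 2 / ε ^ 4 = x ^ 2 := by rw [hx, div_pow, ← pow_mul]
  rw [hx2]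
  have hB1 : (1 : ℝ) ≤ 2 ^ (19008 * x ^ 2) := Real.one_le_rpow (by norm_num) (by positivity)
  have hpow : ∀ {k : ℕ} {y : ℝ}, (k : ℝ) ≤ y → (2 : ℝ) ^ k ≤ 2 ^ y := fun {k y} h => by
    rw [← Real.rpow_natCast]
    exact Real.rpow_le_rpow_of_exponent_le (by norm_num) h
  have hlt : ∀ k : ℕ, (k : ℝ) ≤ 2 ^ k := fun k => by exact_mod_cast Nat.lt_two_pow_self.le
  have hdeg : (degree a ε : ℝ) ≤ 12 * x + 1 := by
    have h1 := Nat.ceil_lt_add_one (a := 12 * x) (by positivity)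
    have h2 : degree a ε = max 1 ⌈12 * x⌉₊ := by rw [degree, hx, mul_div_assoc]
    rw [h2, Nat.cast_max]
    exact max_le (by simpa using hx0) h1.le
  refine ⟨?_, ?_, ?_, hclog, hlog⟩
  · obtain ⟨N, hN⟩ : ∃ N, degree a ε = N + 1 :=
      ⟨_, (Nat.sub_add_cancel (one_le_degree a ε)).symm⟩
    rw [hN] at hdeg ⊢
    push_cast at hdeg ⊢
    have h1 : (N : ℝ) ≤ 12 * x := by linarith
    have h2 : ((N ^ 2 : ℕ) : ℝ) ≤ 19008 * x ^ 2 := by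
      push_cast
      nlinarith [Nat.cast_nonneg (α := ℝ) N]
    have h3 : (N : ℝ) ≤ ((N ^ 2 : ℕ) : ℝ) := by exact_mod_cast Nat.le_self_pow two_ne_zero N
    linarith [hlt (N ^ 2), hpow h2]
  all_goals
    by_cases h : 12 * a ≤ ε ^ 2 ∨ a * 72 ^ degree a ε ≤ 1
  · rw [show parameters n a ε = (0, 1) from if_pos h]
    norm_num
    linarith
  · rw [show parameters n a ε = (degree a ε, Nat.clog 2 n * 2 ^ (32 * degree a ε ^ 2)) from
      if_neg h]
    rw [not_or, not_le, not_le] at h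
    have h1 : 1 ≤ 12 * x := by
      rw [hx, ← mul_div_assoc, le_div_iff₀ (by positivity)]
      linarith [h.1]
    have h2 : ((degree a ε ^ 2 : ℕ) : ℝ) ≤ 19008 * x ^ 2 := by
      push_cast
      nlinarith [Nat.cast_nonneg (α := ℝ) (degree a ε)]
    have h3 := (hlt (degree a ε ^ 2)).trans (hpow h2)
    push_cast at h3
    exact h3
  · rw [show parameters n a ε = (0, 1) from if_pos h]
    norm_num
    nlinarith
  · rw [show parameters n a ε = (degree a ε, Nat.clog 2 n * 2 ^ (32 * degree a ε ^ 2)) from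
      if_neg h]
    rw [not_or, not_le, not_le] at h
    have h1 : 1 ≤ 12 * x := by
      rw [hx, ← mul_div_assoc, le_div_iff₀ (by positivity)]
      linarith [h.1]
    have h2 : ((33 * degree a ε ^ 2 : ℕ) : ℝ) ≤ 19008 * x ^ 2 := by
      push_cast
      nlinarith [Nat.cast_nonneg (α := ℝ) (degree a ε)]
    have h3 : (2 : ℝ) ≤ 2 ^ degree a ε ^ 2 := by
      calc (2 : ℝ) = 2 ^ 1 := by norm_num
        _ ≤ 2 ^ degree a ε ^ 2 :=
          pow_le_pow_right₀ (by norm_num) (Nat.one_le_pow _ _ (one_le_degree a ε))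
    calc ((Nat.clog 2 n * 2 ^ (32 * degree a ε ^ 2) : ℕ) : ℝ)
        = Nat.clog 2 n * 2 ^ (32 * degree a ε ^ 2) := by push_cast; ring
      _ ≤ 2 * Real.logb 2 n * 2 ^ (32 * degree a ε ^ 2) := by gcongr
      _ ≤ 2 ^ degree a ε ^ 2 * Real.logb 2 n * 2 ^ (32 * degree a ε ^ 2) := by gcongr
      _ = Real.logb 2 n * 2 ^ (33 * degree a ε ^ 2) := by
        rw [show 33 * degree a ε ^ 2 = degree a ε ^ 2 + 32 * degree a ε ^ 2 by ring, pow_add]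
        ring
      _ ≤ Real.logb 2 n * 2 ^ (19008 * x ^ 2) := by
        exact mul_le_mul_of_nonneg_left (hpow h2) (by linarith)

/-- The step counts of the training and of the evaluation program. -/
lemma time_bounds {a ε : ℝ} (hn : 2 ≤ n) (ha : 0 ≤ a) (hε : 0 < ε) :
    ((28 + 7 * degree a ε + 3 * Nat.clog 2 n + 96 * (parameters n a ε).1 ^ 2 +
        (parameters n a ε).2 * (9 * n + 6) : ℕ) : ℝ) ≤
      38016 * n * Real.logb 2 n ^ 1 * 2 ^ (38016 * (a ^ 2 / ε ^ 4)) ∧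
    ((12 + n * (7 * (parameters n a ε).2 + 15) + (parameters n a ε).2 *
        (13 + 3 * (parameters n a ε).1 + n * (8 * (parameters n a ε).1 + 8)) : ℕ) : ℝ) ≤
      38016 * n * Real.logb 2 n ^ 1 * 2 ^ (38016 * (a ^ 2 / ε ^ 4)) := by
  obtain ⟨hd, hp1, hp2, hc, hl⟩ := parameter_bounds hn ha hε
  generalize parameters n a ε = p at *
  obtain ⟨p1, m⟩ := p
  have hB : (2 : ℝ) ^ (38016 * (a ^ 2 / ε ^ 4)) = (2 ^ (19008 * (a ^ 2 / ε ^ 4))) ^ 2 := by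
    rw [show 38016 * (a ^ 2 / ε ^ 4) = 19008 * (a ^ 2 / ε ^ 4) + 19008 * (a ^ 2 / ε ^ 4) by ring,
      Real.rpow_add (by norm_num), ← sq]
  have hB1 : (1 : ℝ) ≤ 2 ^ (19008 * (a ^ 2 / ε ^ 4)) :=
    Real.one_le_rpow (by norm_num) (by positivity)
  rw [hB]
  generalize (2 : ℝ) ^ (19008 * (a ^ 2 / ε ^ 4)) = B at *
  generalize Real.logb 2 n = l at *
  generalize degree a ε = D at *
  generalize Nat.clog 2 n = c at *
  have hp1' : (p1 : ℝ) ≤ B := by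
    refine le_trans ?_ hp1
    exact_mod_cast Nat.le_self_pow two_ne_zero p1
  have hn1 : (1 : ℝ) ≤ n := by exact_mod_cast (by omega : 1 ≤ n)
  have hl0 : 0 ≤ l := by linarith
  have hB0 : 0 ≤ B := by linarith
  -- every term is a multiple of `W = n * l * B ^ 2`
  have hnl : (1 : ℝ) ≤ n * l := one_le_mul_of_one_le_of_one_le hn1 hl
  have hBB : B ≤ B ^ 2 := le_self_pow₀ hB1 two_ne_zero
  have hB2 : 1 ≤ B ^ 2 := hB1.trans hBB
  set W : ℝ := n * l * B ^ 2 with hW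
  have hW1 : B ^ 2 ≤ W := le_mul_of_one_le_left (by positivity) hnl
  have hWl : l ≤ W := by
    calc l = 1 * l * 1 := by ring
      _ ≤ W := by rw [hW]; gcongr
  have hWn : (n : ℝ) ≤ W := by
    calc (n : ℝ) = n * 1 * 1 := by ring
      _ ≤ W := by rw [hW]; gcongr
  have hWm : (m : ℝ) ≤ W := by
    calc (m : ℝ) ≤ 1 * l * B := by linarith
      _ ≤ W := by rw [hW]; gcongr
  have hWnm : (n : ℝ) * m ≤ W := by
    calc (n : ℝ) * m ≤ n * (l * B) := by gcongr
      _ = n * l * B := by ring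
      _ ≤ W := by rw [hW]; gcongr
  have hWnmp : (n : ℝ) * m * p1 ≤ W := by
    calc (n : ℝ) * m * p1 ≤ n * (l * B) * B := by gcongr
      _ = W := by rw [hW]; ring
  have hWmp : (m : ℝ) * p1 ≤ W := by
    refine le_trans ?_ hWnmp
    rw [mul_assoc]
    exact le_mul_of_one_le_left (by positivity) hn1
  have hgoal : 38016 * (n : ℝ) * l ^ 1 * B ^ 2 = 38016 * W := by rw [hW]; ring
  rw [hgoal]
  push_cast
  constructor <;> nlinarith

/-! ### The learners -/

/-- The learner for unate functions. -/
def unateLearner : Learner := ⟨trainProg, evalProg, evalProg_noDraw⟩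

lemma unateLearner_outputs {f : Cube n → ℝ} {a ε : ℝ} (hn : 2 ≤ n) (ha : 0 ≤ a) (hε : 0 < ε)
    (ω : ℕ → Cube n) :
    unateLearner.Outputs [ε, a] f ω
      (38016 * n * Real.logb 2 n ^ 1 * 2 ^ (38016 * (a ^ 2 / ε ^ 4)))
      (Real.logb 2 n * 2 ^ (38016 * (a ^ 2 / ε ^ 4)))
      (hypothesis (examples f ω) (parameters n a ε).1 (parameters n a ε).2
        (72 ^ degree a ε)) := by
  obtain ⟨s, t, he, ht, hs, hdrawn⟩ := halts_trainProg (ex := examples f ω) (a := a) hε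
    (s := State.init n [ε, a]) rfl rfl rfl rfl rfl
  obtain ⟨hT, hT'⟩ := time_bounds hn ha hε
  obtain ⟨-, -, hm, -, hl⟩ := parameter_bounds hn ha hε
  refine ⟨s, t, he, le_trans (by exact_mod_cast ht) hT, ?_, fun x => ?_⟩
  · rw [hdrawn]
    refine hm.trans (mul_le_mul_of_nonneg_left ?_ (by linarith))
    exact Real.rpow_le_rpow_of_exponent_le (by norm_num)
      (mul_le_mul_of_nonneg_right (by norm_num) (by positivity))
  · obtain ⟨s', t', he', ht', hs'⟩ := halts_evalProg (ex' := examples f ω) x hs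
    exact ⟨s', t', he', le_trans (by exact_mod_cast ht') hT', hs'⟩

lemma unateLearner_learns {a ε : ℝ} (hn : 2 ≤ n) (hε : 0 < ε) :
    unateLearner.Learns [ε, a] (unateClass n a) ε
      (38016 * n * Real.logb 2 n ^ 1 * 2 ^ (38016 * (a ^ 2 / ε ^ 4)))
      (Real.logb 2 n * 2 ^ (38016 * (a ^ 2 / ε ^ 4))) := by
  intro f hf
  have hout := unateLearner_outputs (f := f) hn (unateClass_nonneg hf) hε
  refine ⟨fun ω => ⟨_, hout ω⟩, (two_thirds_le_measureReal hn hf hε).trans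
    (MeasureTheory.measureReal_mono fun ω hω => ⟨_, hout ω, ?_⟩)⟩
  rw [l2norm, Real.sqrt_le_left hε.le]
  exact hω

/-- The learner for XOS functions: the learner for unate functions, run with the bound `1` on the
total influence. -/
def xosLearner : Learner :=
  ⟨.seq (.instr (.realConst 1 1)) trainProg, evalProg, evalProg_noDraw⟩

lemma xosLearner_outputs {f : Cube n → ℝ} {ε T T' m m' : ℝ} {ω : ℕ → Cube n} {h : Cube n → ℝ}
    (hT : T + 1 ≤ T') (hm : m ≤ m') (ho : unateLearner.Outputs [ε, 1] f ω T m h) :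
    xosLearner.Outputs [ε] f ω T' m' h := by
  obtain ⟨s, t, he, ht, hd, heval⟩ := ho
  have hinit : Instr.exec (examples f ω) (State.init n [ε]) (.realConst 1 1) =
      State.init n [ε, 1] := by
    simp only [Instr.exec, State.setReal, State.init, State.mk.injEq, true_and, and_true]
    funext i
    rcases i with _ | _ | i <;> simp
  refine ⟨s, 1 + t, .seq (.instr _ _) (hinit ▸ he), ?_, hd.trans hm, fun x => ?_⟩
  · push_cast
    linarith
  · obtain ⟨s', t', he', ht', hx⟩ := heval x
    exact ⟨s', t', he', by linarith, hx⟩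

lemma xosLearner_learns {ε : ℝ} (hn : 2 ≤ n) (hε : 0 < ε) :
    xosLearner.Learns [ε] (xosClass n) ε
      (38017 * n ^ 2 * 2 ^ ((38017 : ℝ) * (1 / ε ^ 4)))
      (Real.logb 2 n * 2 ^ ((38017 : ℝ) * (1 / ε ^ 4))) := by
  intro f hf
  obtain ⟨h1, h2⟩ := unateLearner_learns (a := 1) hn hε f (xosClass_subset_unateClass hf)
  obtain ⟨-, -, -, -, hl⟩ := parameter_bounds (a := 1) hn zero_le_one hε
  have hn1 : (1 : ℝ) ≤ n := by exact_mod_cast (by omega : 1 ≤ n)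
  have hln : Real.logb 2 n ≤ n := by
    rw [Real.logb_le_iff_le_rpow (by norm_num) (by positivity), Real.rpow_natCast]
    exact_mod_cast Nat.lt_two_pow_self.le
  have hB : (2 : ℝ) ^ ((38016 : ℝ) * (1 ^ 2 / ε ^ 4)) ≤ 2 ^ ((38017 : ℝ) * (1 / ε ^ 4)) := by
    rw [one_pow]
    exact Real.rpow_le_rpow_of_exponent_le (by norm_num)
      (mul_le_mul_of_nonneg_right (by norm_num) (by positivity))
  have hB1 : (1 : ℝ) ≤ 2 ^ ((38017 : ℝ) * (1 / ε ^ 4)) :=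
    Real.one_le_rpow (by norm_num) (by positivity)
  have hm := mul_le_mul_of_nonneg_left hB (by linarith : 0 ≤ Real.logb 2 n)
  have hT : 38016 * n * Real.logb 2 n ^ 1 * 2 ^ ((38016 : ℝ) * (1 ^ 2 / ε ^ 4)) + 1 ≤
      38017 * (n : ℝ) ^ 2 * 2 ^ ((38017 : ℝ) * (1 / ε ^ 4)) := by
    have h3 : 38016 * n * Real.logb 2 n ^ 1 * 2 ^ ((38016 : ℝ) * (1 ^ 2 / ε ^ 4)) ≤
        38016 * (n : ℝ) * n ^ 1 * 2 ^ ((38017 : ℝ) * (1 / ε ^ 4)) := by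
      gcongr
    have h4 : 1 ≤ (n : ℝ) ^ 2 * 2 ^ ((38017 : ℝ) * (1 / ε ^ 4)) :=
      one_le_mul_of_one_le_of_one_le (one_le_pow₀ hn1) hB1
    linarith
  refine ⟨fun ω => ?_, h2.trans (MeasureTheory.measureReal_mono ?_)⟩
  · obtain ⟨h, ho⟩ := h1 ω
    exact ⟨h, xosLearner_outputs hT hm ho⟩
  · rintro ω ⟨h, ho, hh⟩
    exact ⟨h, xosLearner_outputs hT hm ho, hh⟩

end Learning

theorem theorem5 :
    (∃ (L : Learning.Learner) (C : ℝ) (k : ℕ), ∀ (n : ℕ) (a ε : ℝ), 2 ≤ n → 0 < ε →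
      L.Learns [ε, a] (Learning.unateClass n a) ε
        (C * n * Real.logb 2 n ^ k * (2 : ℝ) ^ (C * (a ^ 2 / ε ^ 4)))
        (Real.logb 2 n * (2 : ℝ) ^ (C * (a ^ 2 / ε ^ 4)))) ∧
    (∃ (L : Learning.Learner) (C : ℝ) (k : ℕ), ∀ (n : ℕ) (ε : ℝ), 2 ≤ n → 0 < ε →
      L.Learns [ε] (Learning.xosClass n) ε
        (C * n ^ k * (2 : ℝ) ^ (C * (1 / ε ^ 4)))
        (Real.logb 2 n * (2 : ℝ) ^ (C * (1 / ε ^ 4)))) :=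
  ⟨⟨Learning.unateLearner, 38016, 1, fun _ _ _ hn hε => Learning.unateLearner_learns hn hε⟩,
    ⟨Learning.xosLearner, 38017, 2, fun _ _ hn hε => Learning.xosLearner_learns hn hε⟩⟩
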